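/- **Conventions.** Types, terms and processes are taken up to renaming of bound variables. Labels $l$ range over a countably infinite set, and in $\{l_i\colon\cdot\}_{i\in I}$ the index set $I$ is finite and the labels $l_i$ are distinct; $\mathsf{Fst}\ne\mathsf{Snd}$ are two fixed labels. A substitution is always capture-avoiding. **Kinds and types.** Proper kinds are $*::=\mathsf S\mid\mathsf T$ (session, functional); kinds are $\kappa::=*\mid\kappa\Rightarrow\kappa$. Types are $T::=\iota\mid\alpha\mid\lambda\alpha{:}\kappa.T\mid T\,T$ with constants $\iota$ of the following kinds, where each occurrence of $*$ may independently be $\mathsf S$ or $\mathsf T$: $\to\;:*\Rightarrow*\Rightarrow\mathsf T$; records $\{\overline{l_i}\}$ and variants $\langle\overline{l_i}\rangle$ of kind $\overline{*\Rightarrow}\,\mathsf T$; $\mu_\kappa:(\kappa\Rightarrow\kappa)\Rightarrow\kappa$; $\forall_\kappa:(\kappa\Rightarrow*)\Rightarrow\mathsf T$; $\mathsf{Skip},\mathsf{End}:\mathsf S$; messages $\sharp\in\{?,!\}$ of kind $*\Rightarrow\mathsf S$; sequential composition $;\,:\mathsf S\Rightarrow\mathsf S\Rightarrow\mathsf S$;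 choices $\odot\{\overline{l_i}\}:\overline{\mathsf S\Rightarrow}\,\mathsf S$ with $\odot\in\{\&,\oplus\}$; $\mathsf{Dual}:\mathsf S\Rightarrow\mathsf S$. We write $T\to U$, $T;U$, $\{l_i\colon T_i\}$, $\langle l_i\colon T_i\rangle$, $\odot\{l_i\colon T_i\}$ for the applied constants, $\forall\alpha{:}\kappa.T$ for $\forall_\kappa(\lambda\alpha{:}\kappa.T)$, $\mathsf{Unit}$ for the empty record type and $T\times U$ for $\{\mathsf{Fst}\colon T,\mathsf{Snd}\colon U\}$. **Type reduction** $T\longrightarrow U$ is generated by $\mathsf{Skip};T\longrightarrow T$; $(T;U);V\longrightarrow T;(U;V)$; $\mu_\kappa T\longrightarrow T(\mu_\kappa T)$; $(\lambda\alpha{:}\kappa.T)U\longrightarrow T[U/\alpha]$; $\mathsf{Dual}(T;U)\longrightarrow\mathsf{Dual}\,T;\mathsf{Dual}\,U$; $\mathsf{Dual}\,\mathsf{Skip}\longrightarrow\mathsf{Skip}$; $\mathsf{Dual}\,\mathsf{End}\longrightarrow\mathsf{End}$; $\mathsf{Dual}(?T)\longrightarrow{!T}$; $\mathsf{Dual}(!T)\longrightarrow{?T}$;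 $\mathsf{Dual}(\&\{l_i\colon T_i\})\longrightarrow\oplus\{l_i\colon\mathsf{Dual}\,T_i\}$ and dually with $\oplus$ and $\&$ exchanged; $\mathsf{Dual}(\mathsf{Dual}(\alpha\,T_1\cdots T_m))\longrightarrow\alpha\,T_1\cdots T_m$; and, whenever $T\longrightarrow U$, by $T;V\longrightarrow U;V$, $T\,V\longrightarrow U\,V$ and $\mathsf{Dual}\,T\longrightarrow\mathsf{Dual}\,U$. The weak head normal forms are: constants; $\iota\,T_1\cdots T_m$ ($m\ge1$) with $\iota$ not $;$, $\mu_\kappa$ or $\mathsf{Dual}$; the partial application $(;)\,T$; $(;)\,T_1\cdots T_m$ ($m\ge2$) with $T_1$ a weak head normal form other than $\mathsf{Skip}$ and $U;V$; $\alpha\,T_1\cdots T_m$ ($m\ge0$); abstractions; $\mathsf{Dual}\,T_1\cdots T_m$ ($m\ge1$) with $T_1$ a weak head normal form not of the form $\mathsf{Skip}$, $\mathsf{End}$, $\sharp U$, $U;V$, $\odot\{l_i\colon U_i\}$ or $\mathsf{Dual}(\alpha\,U_1\cdots U_n)$. $T$ *normalises* if some finite reduction sequence from $T$ ends in a weak head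 normal form. **Type formation** $\Delta\vdash T:\kappa$ ($\Delta$ assigns kinds to type variables): constants and variables have their kinds; $\Delta\vdash\lambda\alpha{:}\kappa.T:\kappa\Rightarrow\kappa'$ if $\Delta+\alpha{:}\kappa\vdash T:\kappa'$ ($+$ is update of the context); $\Delta\vdash T\,U:\kappa'$ if $\Delta\vdash T:\kappa\Rightarrow\kappa'$, $\Delta\vdash U:\kappa$ and $T\,U$ normalises. **Type equivalence** $T\sim U$ is the largest bisimulation for the following labelled transition system. If $T\longrightarrow U\xrightarrow{a}V$ then $T\xrightarrow{a}V$. For $m\ge0$ and $1\le j\le m$: $\alpha T_1\cdots T_m\xrightarrow{\alpha_0}\mathsf{Skip}$ and $\xrightarrow{\alpha_j}T_j$; $\alpha T_1\cdots T_m;U\xrightarrow{\alpha_0}U$ and $\xrightarrow{\alpha_j}T_j$; $\iota\xrightarrow{\iota_0}\mathsf{Skip}$ for $\iota\ne\mathsf{Skip}$; $\iota T_1\cdots T_m\xrightarrow{\iota_j}T_j$ for $\iota$ among $\to$, $\forall_\kappa$, choices, records and variants; $\lambda\alpha{:}\kappa.T\xrightarrow{\lambda\alpha:\kappa}T$, where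 two abstractions are compared after renaming their bound variables to the same fresh variable; $\sharp T\xrightarrow{\sharp_1}T$ and $\xrightarrow{\sharp_2}\mathsf{Skip}$; $\sharp T;U\xrightarrow{\sharp_1}T$ and $\xrightarrow{\sharp_2}U$; $(;)\,T\xrightarrow{;_1}T$; $\odot\{l_i\colon T_i\};U\xrightarrow{\odot\{\overline{l_i}\}_j}T_j;U$; $\mathsf{End};U\xrightarrow{\mathsf{End}_0}\mathsf{Skip}$; and, with $V=\alpha T_1\cdots T_m$, $\mathsf{Dual}\,V\xrightarrow{\mathsf{Dual}_1}V$ and $\xrightarrow{\mathsf{Dual}_2}\mathsf{Skip}$, $\mathsf{Dual}\,V;U\xrightarrow{\mathsf{Dual}_1}V$ and $\xrightarrow{\mathsf{Dual}_2}U$. **Terms and processes.** Values $v,u,w$, terms $t$, processes $p$ and evaluation contexts $E$ are $$v::=c\mid x\mid\lambda x{:}T.t\mid\mathsf{rec}\,x{:}T.v\mid\Lambda\alpha{:}\kappa.v\mid\{l_i=v_i\}\mid\langle l=v\rangle_T\mid\mathsf{receive}[T]\mid\mathsf{receive}[T][T]\mid\mathsf{send}[T]\mid\mathsf{send}[T]\,v\mid(\mathsf{send}[T]\,v)[T]$$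 $$t::=v\mid t\,t\mid t[T]\mid\{l_i=t_i\}\mid\mathsf{let}\,\{l_i=x_i\}=t\,\mathsf{in}\,t\mid\langle l=t\rangle_T\mid\mathsf{case}\,t\,\mathsf{of}\,t\mid\mathsf{match}\,t\,\mathsf{with}\,t\qquad p::=\langle t\rangle\mid p\mid p\ \big|\ (\nu xy)p$$ $$E::=[]\mid E\,t\mid v\,E\mid E[T]\mid\{\overline{l=v},l_j=E,\overline{l=t}\}\mid\mathsf{let}\,\{l_i=x_i\}=E\,\mathsf{in}\,t\mid\langle l=E\rangle_T\mid\mathsf{case}\,E\,\mathsf{of}\,t\mid\mathsf{match}\,E\,\mathsf{with}\,t$$ with constants $c$ of types $T_c$: $\mathsf{receive}:\forall\alpha{:}\mathsf T.\forall\beta{:}\mathsf S.(?\alpha;\beta)\to\alpha\times\beta$; $\mathsf{send}:\forall\alpha{:}\mathsf T.\alpha\to\forall\beta{:}\mathsf S.(!\alpha;\beta)\to\beta$; $\mathsf{select}\,l_j$ annotated with $\oplus\{l_i\colon T_i\}$, of type $\oplus\{l_i\colon T_i\}\to T_j$; $\mathsf{close}:\mathsf{End}\to\mathsf{Unit}$;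 $\mathsf{fork}:(\mathsf{Unit}\to\mathsf{Unit})\to\mathsf{Unit}$; $\mathsf{new}:\forall\alpha{:}\mathsf S.\alpha\times\mathsf{Dual}\,\alpha$. Structural congruence $\equiv$ is the least congruence with $|$ commutative and associative, $(\nu xy)p_1\mid p_2\equiv(\nu xy)(p_1\mid p_2)$ for $x,y$ not free in $p_2$, and $(\nu wx)(\nu yz)p\equiv(\nu yz)(\nu wx)p$. **Typing.** A context $\Gamma$ is a finite set of bindings, linear $x:T$ or unrestricted $x:^\omega T$, of distinct variables; $\Gamma_1,\Gamma_2$ is disjoint union, and $\Delta\vdash T:*$ means that $T$ has kind $\mathsf S$ or $\mathsf T$. The judgement $\Delta\mid\Gamma\vdash t:T$ is generated by: (1) $\Delta\mid\cdot\vdash c:T_c$ if $\Delta\vdash T_c:*$; (2) $\Delta\mid x:T\vdash x:T$; (3) $\Delta\mid\Gamma\vdash\lambda x{:}T.t:T\to U$ if $\Delta\vdash T:*$ and $\Delta\mid\Gamma,x:T\vdash t:U$; (4) $\Delta\mid\Gamma_1,\Gamma_2\vdash t_1t_2:T$ if $\Delta\mid\Gamma_1\vdash t_1:U\to T$ and $\Delta\mid\Gamma_2\vdash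 t_2:U$; (5) $\Delta\mid\Gamma\vdash\mathsf{rec}\,x{:}T\to U.v:T\to U$ if $\Delta\vdash T:*$ and $\Delta\mid\Gamma,x:^\omega T\to U\vdash v:T\to U$; (6) $\Delta\mid\Gamma\vdash\Lambda\alpha{:}\kappa.v:\forall_\kappa T$ if $\Delta,\alpha{:}\kappa\mid\Gamma\vdash v:T\,\alpha$, with $\alpha$ not free in $\Gamma,T$; (7) $\Delta\mid\Gamma\vdash t[U]:T\,U$ if $\Delta\mid\Gamma\vdash t:\forall_\kappa T$ and $\Delta\vdash U:\kappa$; (8) $\Delta\mid\overline{\Gamma}\vdash\{l_i=t_i\}:\{l_i\colon T_i\}$ if $\Delta\mid\Gamma_i\vdash t_i:T_i$ for all $i$; (9) $\Delta\mid\Gamma_1,\Gamma_2\vdash\mathsf{let}\,\{l_i=x_i\}=t_1\,\mathsf{in}\,t_2:T$ if $\Delta\mid\Gamma_1\vdash t_1:\{l_i\colon T_i\}$ and $\Delta\mid\Gamma_2,\overline{x_i:T_i}\vdash t_2:T$; (10) with $T=\langle l_i\colon T_i\rangle$, $\Delta\mid\Gamma\vdash\langle l_j=t\rangle_T:T$ if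 $\Delta\vdash T:*$ and $\Delta\mid\Gamma\vdash t:T_j$; (11) $\Delta\mid\Gamma_1,\Gamma_2\vdash\mathsf{case}\,t_1\,\mathsf{of}\,t_2:T$ if $\Delta\mid\Gamma_1\vdash t_1:\langle l_i\colon T_i\rangle$ and $\Delta\mid\Gamma_2\vdash t_2:\{l_i\colon T_i\to T\}$; (12) $\Delta\mid\Gamma_1,\Gamma_2\vdash\mathsf{match}\,t_1\,\mathsf{with}\,t_2:T$ if $\Delta\mid\Gamma_1\vdash t_1:\&\{l_i\colon T_i\}$ and $\Delta\mid\Gamma_2\vdash t_2:\{l_i\colon T_i\to T\}$; (13) $\Delta\mid\Gamma\vdash t:T$ if $\Delta\mid\Gamma\vdash t:U$, $\Delta\vdash U:*$ and $U\sim T$; (14) dereliction: $\Gamma,x:^\omega T\vdash t:U$ if $\Gamma,x:T\vdash t:U$; weakening: $\Gamma,x:^\omega T\vdash t:U$ if $\Gamma\vdash t:U$; contraction: $\Gamma,x:^\omega T\vdash t[x/y][x/z]:U$ if $\Gamma,y:^\omega T,z:^\omega T\vdash t:U$ (all under $\Delta$). Process typing $\Gamma\vdash p$: $\Gamma\vdash\langle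 t\rangle$ if $\emptyset\mid\Gamma\vdash t:\mathsf{Unit}$; $\Gamma_1,\Gamma_2\vdash p_1\mid p_2$ if $\Gamma_1\vdash p_1$ and $\Gamma_2\vdash p_2$; $\Gamma\vdash(\nu xy)p$ if $\Gamma,x:T,y:\mathsf{Dual}\,T\vdash p$ for some $T$ with $\emptyset\vdash T:\mathsf S$. We write $\Gamma^{\mathsf S}$ for a context all of whose types $T$ satisfy $\emptyset\vdash T:\mathsf S$. **Runtime errors.** The session operations on $t$ are $\mathsf{receive}[T][U]\,t$, $(\mathsf{send}[T]\,v)[U]\,t$, $\mathsf{match}\,t\,\mathsf{with}\,t'$, $(\mathsf{select}\,l)\,t$, $\mathsf{close}\,t$; the *subject* of a session operation on a variable $x$ is $x$ (no other term has a subject). Two session operations, one with subject $x$ and one with subject $y$, *agree* on $xy$ if they are a $\mathsf{receive}$ and a $\mathsf{send}$, two $\mathsf{close}$, or a $\mathsf{match}\,\cdot\,\mathsf{with}\,t$ and a $\mathsf{select}\,l$ where $t$ either is a record expression that has a field $l$ or is neither a value nor a record expression (so that it is still to be evaluated). A process is a *runtime error* if it is structurally congruent to a process that contains a subexpression, at any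 depth, or a subprocess of one of the following forms, where in 1–4 the values $v$ required not to be of some form, as well as the value $t$ in the last case of 4, are not variables bound inside the thread by $\lambda$, $\mathsf{rec}$ or $\mathsf{let}$: 1. $v\,u$ where $v$ is not of the form $\lambda x{:}T.t$, $\mathsf{rec}\,x{:}T.w$, $\mathsf{receive}[T][U]$, $\mathsf{send}[T]$, $(\mathsf{send}[T]\,w)[U]$, $\mathsf{select}\,l$, $\mathsf{close}$ or $\mathsf{fork}$; 2. $v[T]$ where $v$ is not of the form $\Lambda\alpha{:}\kappa.w$, $\mathsf{receive}$, $\mathsf{receive}[U]$, $\mathsf{send}$, $\mathsf{send}[U]\,w$ or $\mathsf{new}$; 3. $\mathsf{let}\,\{l_i=x_i\}=v\,\mathsf{in}\,t$ where $v$ is not of the form $\{l_i=u_i\}$ with the same labels; 4. $\mathsf{case}\,v\,\mathsf{of}\,t$ where $v$ is not of the form $\langle l=u\rangle_T$; or $v=\langle l=u\rangle_T$ and $t$ is a record expression without a field $l$; or $t$ is a value that is not a record; 5. a session operation on a value $v$ that is not a variable; 6. $\langle E_1[e_1]\rangle\mid\langle E_2[e_2]\rangle$ where $e_1$ and $e_2$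 have the same subject; 7. $(\nu xy)(\langle E_1[e_1]\rangle\mid\langle E_2[e_2]\rangle)$ where $e_1$ has subject $x$, $e_2$ has subject $y$, and $e_1,e_2$ do not agree on $xy$. **Theorem (Safety).** If $\Gamma^{\mathsf S}\vdash p$, then $p$ is not a runtime error. -/

import Mathlib

namespace FMu

/-! Syntax is taken up to renaming of bound variables: type variables and term variables are
de Bruijn indices, counted separately. -/

/-! ### Kinds and types -/

/-- Record, variant and choice labels. -/
abbrev Label := ℕ

/-- The kinds of proper types: session `S` and functional `T`. -/
inductive PKind where
  | S
  | T

inductive Kind where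
  | proper (p : PKind)
  | arr (κ κ' : Kind)

abbrev Kind.S : Kind := .proper .S
abbrev Kind.T : Kind := .proper .T

/-- `arrs [κ₁, …, κₙ] κ` is `κ₁ ⇒ ⋯ ⇒ κₙ ⇒ κ`. -/
def Kind.arrs (κs : List Kind) (κ : Kind) : Kind := κs.foldr Kind.arr κ

/-- Polarity of a message: input `?`, output `!`. -/
inductive Pol where
  | inp
  | out

def Pol.dual : Pol → Pol
  | .inp => .out
  | .out => .inp

/-- View of a choice: external `&`, internal `⊕`. -/
inductive View where
  | ext
  | int

def View.dual : View → View
  | .ext => .int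
  | .int => .ext

/-- Type constants. Records, variants and choices carry their set of labels and take one argument
per label, in increasing order of the labels. -/
inductive TConst where
  | arrow
  | record (L : Finset Label)
  | variant (L : Finset Label)
  | mu (κ : Kind)
  | all (κ : Kind)
  | skip
  | fin
  | msg (s : Pol)
  | seq
  | choice (v : View) (L : Finset Label)
  | dual

/-- Kinds of type constants. Each occurrence of a proper kind may be instantiated with `S` or with
`T` independently, so this is a relation. -/
inductive ConstKind : TConst → Kind → Prop
  | arrow (p q : PKind) : ConstKind .arrow (.arr (.proper p) (.arr (.proper q) .T))
  | record (L : Finset Label) (ps : List PKind) (h : ps.length = L.card) :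
      ConstKind (.record L) (Kind.arrs (ps.map Kind.proper) .T)
  | variant (L : Finset Label) (ps : List PKind) (h : ps.length = L.card) :
      ConstKind (.variant L) (Kind.arrs (ps.map Kind.proper) .T)
  | mu (κ : Kind) : ConstKind (.mu κ) (.arr (.arr κ κ) κ)
  | all (κ : Kind) (p : PKind) : ConstKind (.all κ) (.arr (.arr κ (.proper p)) .T)
  | skip : ConstKind .skip .S
  | fin : ConstKind .fin .S
  | msg (s : Pol) (p : PKind) : ConstKind (.msg s) (.arr (.proper p) .S)
  | seq : ConstKind .seq (.arr .S (.arr .S .S))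
  | choice (v : View) (L : Finset Label) :
      ConstKind (.choice v L) (Kind.arrs (List.replicate L.card .S) .S)
  | dual : ConstKind .dual (.arr .S .S)

inductive Ty where
  | const (ι : TConst)
  | var (a : ℕ)
  | lam (κ : Kind) (A : Ty)
  | app (A B : Ty)

namespace Ty

def rename (ρ : ℕ → ℕ) : Ty → Ty
  | const ι => const ι
  | var a => var (ρ a)
  | lam κ A => lam κ (A.rename (fun n => Nat.casesOn n 0 (fun m => ρ m + 1)))
  | app A B => app (A.rename ρ) (B.rename ρ)

/-- Weakening by one fresh type variable. -/
def shift (A : Ty) : Ty := A.rename Nat.succ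

def subst (σ : ℕ → Ty) : Ty → Ty
  | const ι => const ι
  | var a => σ a
  | lam κ A => lam κ (A.subst (fun n => Nat.casesOn n (var 0) (fun m => (σ m).shift)))
  | app A B => app (A.subst σ) (B.subst σ)

/-- Substitution of `B` for the type variable `0` in `A`. -/
def inst (A B : Ty) : Ty := A.subst (fun n => Nat.casesOn n B var)

/-- `A.apps [B₁, …, Bₘ]` is `A B₁ ⋯ Bₘ`. -/
def apps (A : Ty) (Bs : List Ty) : Ty := Bs.foldl app A

def skip : Ty := const .skip
def fin : Ty := const .fin
def seq (A B : Ty) : Ty := app (app (const .seq) A) B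
def dual (A : Ty) : Ty := app (const .dual) A
def msg (s : Pol) (A : Ty) : Ty := app (const (.msg s)) A
def arrow (A B : Ty) : Ty := app (app (const .arrow) A) B
/-- `∀ α : κ. A`, with `α` the variable `0` of `A`. -/
def all (κ : Kind) (A : Ty) : Ty := app (const (.all κ)) (lam κ A)

/-- The types `F l` for `l ∈ L`, in increasing order of the labels. -/
def row (L : Finset Label) (F : Label → Ty) : List Ty := (L.sort (· ≤ ·)).map F
/-- The record type `{l : F l}` for `l ∈ L`. -/
def record (L : Finset Label) (F : Label → Ty) : Ty := apps (const (.record L)) (row L F)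
/-- The variant type `⟨l : F l⟩` for `l ∈ L`. -/
def variant (L : Finset Label) (F : Label → Ty) : Ty := apps (const (.variant L)) (row L F)
/-- The choice type `&{l : F l}` or `⊕{l : F l}` for `l ∈ L`. -/
def choice (v : View) (L : Finset Label) (F : Label → Ty) : Ty :=
  apps (const (.choice v L)) (row L F)

def unit : Ty := record ∅ (fun _ => skip)

/-- Pairs are records with the two labels `Fst = 0` and `Snd = 1`. -/
def pair (A B : Ty) : Ty := record {0, 1} (fun l => if l = 0 then A else B)

end Ty

/-! ### Type reduction, normalisation and type formation -/

inductive TyRed : Ty → Ty → Prop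
  | seq1 (A : Ty) : TyRed (.seq .skip A) A
  | seq2 {A A' : Ty} (B : Ty) (h : TyRed A A') : TyRed (.seq A B) (.seq A' B)
  | assoc (A B C : Ty) : TyRed (.seq (.seq A B) C) (.seq A (.seq B C))
  | mu (κ : Kind) (A : Ty) :
      TyRed (.app (.const (.mu κ)) A) (.app A (.app (.const (.mu κ)) A))
  | beta (κ : Kind) (A B : Ty) : TyRed (.app (.lam κ A) B) (A.inst B)
  | tappL {A A' : Ty} (B : Ty) (h : TyRed A A') : TyRed (.app A B) (.app A' B)
  | dualSeq (A B : Ty) : TyRed (.dual (.seq A B)) (.seq (.dual A) (.dual B))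
  | dualSkip : TyRed (.dual .skip) .skip
  | dualFin : TyRed (.dual .fin) .fin
  | dualMsg (s : Pol) (A : Ty) : TyRed (.dual (.msg s A)) (.msg s.dual A)
  | dualChoice (v : View) (L : Finset Label) (As : List Ty) (h : As.length = L.card) :
      TyRed (.dual (Ty.apps (.const (.choice v L)) As))
        (Ty.apps (.const (.choice v.dual L)) (As.map Ty.dual))
  | dualCtx {A A' : Ty} (h : TyRed A A') : TyRed (.dual A) (.dual A')
  | dualDualVar (a : ℕ) (As : List Ty) :
      TyRed (.dual (.dual (Ty.apps (.var a) As))) (Ty.apps (.var a) As)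

/-- Weak head normal forms. -/
inductive Whnf : Ty → Prop
  | const0 (ι : TConst) : Whnf (.const ι)
  | const1 (ι : TConst) (As : List Ty) (hseq : ι ≠ .seq) (hmu : ∀ κ, ι ≠ .mu κ)
      (hdual : ι ≠ .dual) (hm : As ≠ []) : Whnf (Ty.apps (.const ι) As)
  | seq1 (A : Ty) : Whnf (.app (.const .seq) A)
  | seq2 (A B : Ty) (Cs : List Ty) (h : Whnf A) (hseq : ∀ C D, A ≠ .seq C D)
      (hskip : A ≠ .skip) : Whnf (Ty.apps (.seq A B) Cs)
  | var (a : ℕ) (As : List Ty) : Whnf (Ty.apps (.var a) As)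
  | lam (κ : Kind) (A : Ty) : Whnf (.lam κ A)
  | dual (A : Ty) (Cs : List Ty) (h : Whnf A) (hskip : A ≠ .skip) (hfin : A ≠ .fin)
      (hmsg : ∀ s B, A ≠ .msg s B) (hseq : ∀ B C, A ≠ .seq B C)
      (hchoice : ∀ v L (Bs : List Ty), Bs.length = L.card → A ≠ Ty.apps (.const (.choice v L)) Bs)
      (hdual : ∀ a Bs, A ≠ .dual (Ty.apps (.var a) Bs)) : Whnf (Ty.apps (.dual A) Cs)

/-- `A` reduces in finitely many steps to a weak head normal form. -/
def Normalises (A : Ty) : Prop := ∃ B, Relation.ReflTransGen TyRed A B ∧ Whnf B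

/-- Type formation. The kinding context lists the kinds of the type variables `0, 1, …`. -/
inductive Kinding : List Kind → Ty → Kind → Prop
  | const (Δ : List Kind) {ι : TConst} {κ : Kind} (h : ConstKind ι κ) : Kinding Δ (.const ι) κ
  | var {Δ : List Kind} {a : ℕ} {κ : Kind} (h : Δ[a]? = some κ) : Kinding Δ (.var a) κ
  | lam {Δ : List Kind} {κ κ' : Kind} {A : Ty} (h : Kinding (κ :: Δ) A κ') :
      Kinding Δ (.lam κ A) (.arr κ κ')
  | app {Δ : List Kind} {κ κ' : Kind} {A B : Ty} (hA : Kinding Δ A (.arr κ κ'))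
      (hB : Kinding Δ B κ) (hn : Normalises (.app A B)) : Kinding Δ (.app A B) κ'

/-- `A` is a proper type: its kind is `S` or `T`. -/
def ProperTy (Δ : List Kind) (A : Ty) : Prop := ∃ p : PKind, Kinding Δ A (.proper p)

/-! ### Type equivalence -/

/-- Transition labels: `αᵢ`, `ιᵢ` and `λ:κ`. -/
inductive TLabel where
  | var (a i : ℕ)
  | const (ι : TConst) (i : ℕ)
  | lam (κ : Kind)

/-- The constants whose arguments are all visible as transitions. -/
inductive Transparent : TConst → Prop
  | arrow : Transparent .arrow
  | all (κ : Kind) : Transparent (.all κ)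
  | choice (v : View) (L : Finset Label) : Transparent (.choice v L)
  | record (L : Finset Label) : Transparent (.record L)
  | variant (L : Finset Label) : Transparent (.variant L)

/-- The labelled transition system on types. Arguments are numbered from `1`, so that the `j + 1`st
argument is the one at position `j` of the list. An abstraction steps to its body, where
the bound variable is the variable `0`. -/
inductive Step : Ty → TLabel → Ty → Prop
  | red {A B C : Ty} {a : TLabel} (h : TyRed A B) (h' : Step B a C) : Step A a C
  | var1 (a : ℕ) (As : List Ty) : Step (Ty.apps (.var a) As) (.var a 0) .skip
  | var2 (a : ℕ) (As : List Ty) (j : ℕ) (B : Ty) (h : As[j]? = some B) :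
      Step (Ty.apps (.var a) As) (.var a (j + 1)) B
  | const (ι : TConst) (h : ι ≠ .skip) : Step (.const ι) (.const ι 0) .skip
  | constApp (ι : TConst) (As : List Ty) (j : ℕ) (B : Ty) (hι : Transparent ι)
      (h : As[j]? = some B) : Step (Ty.apps (.const ι) As) (.const ι (j + 1)) B
  | lam (κ : Kind) (A : Ty) : Step (.lam κ A) (.lam κ) A
  | msg1 (s : Pol) (A : Ty) : Step (.msg s A) (.const (.msg s) 1) A
  | msg2 (s : Pol) (A : Ty) : Step (.msg s A) (.const (.msg s) 2) .skip
  | seq1 (A : Ty) : Step (.app (.const .seq) A) (.const .seq 1) A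
  | varSeq1 (a : ℕ) (As : List Ty) (B : Ty) :
      Step (.seq (Ty.apps (.var a) As) B) (.var a 0) B
  | varSeq2 (a : ℕ) (As : List Ty) (B : Ty) (j : ℕ) (C : Ty) (h : As[j]? = some C) :
      Step (.seq (Ty.apps (.var a) As) B) (.var a (j + 1)) C
  | msgSeq1 (s : Pol) (A B : Ty) : Step (.seq (.msg s A) B) (.const (.msg s) 1) A
  | msgSeq2 (s : Pol) (A B : Ty) : Step (.seq (.msg s A) B) (.const (.msg s) 2) B
  | choiceSeq (v : View) (L : Finset Label) (As : List Ty) (B : Ty) (hl : As.length = L.card)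
      (j : ℕ) (C : Ty) (h : As[j]? = some C) :
      Step (.seq (Ty.apps (.const (.choice v L)) As) B) (.const (.choice v L) (j + 1)) (.seq C B)
  | finSeq (B : Ty) : Step (.seq .fin B) (.const .fin 0) .skip
  | dualVar1 (a : ℕ) (As : List Ty) :
      Step (.dual (Ty.apps (.var a) As)) (.const .dual 1) (Ty.apps (.var a) As)
  | dualVar2 (a : ℕ) (As : List Ty) :
      Step (.dual (Ty.apps (.var a) As)) (.const .dual 2) .skip
  | dualSeq1 (a : ℕ) (As : List Ty) (B : Ty) :
      Step (.seq (.dual (Ty.apps (.var a) As)) B) (.const .dual 1) (Ty.apps (.var a) As)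
  | dualSeq2 (a : ℕ) (As : List Ty) (B : Ty) :
      Step (.seq (.dual (Ty.apps (.var a) As)) B) (.const .dual 2) B

def IsBisimulation (R : Ty → Ty → Prop) : Prop :=
  ∀ A B, R A B → ∀ a,
    (∀ A', Step A a A' → ∃ B', Step B a B' ∧ R A' B') ∧
    (∀ B', Step B a B' → ∃ A', Step A a A' ∧ R A' B')

/-- Type equivalence. -/
def Bisim (A B : Ty) : Prop := ∃ R, IsBisimulation R ∧ R A B

/-! ### Terms and processes -/

inductive TmConst where
  | receive
  | send
  /-- `select` of the label `l`, annotated with the internal choice type `A`. -/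
  | select (l : Label) (A : Ty)
  | close
  | fork
  | new

/-- Types of term constants. -/
inductive ConstTy : TmConst → Ty → Prop
  | receive : ConstTy .receive
      (.all .T (.all .S (.arrow (.seq (.msg .inp (.var 1)) (.var 0)) (.pair (.var 1) (.var 0)))))
  | send : ConstTy .send
      (.all .T (.arrow (.var 0)
        (.all .S (.arrow (.seq (.msg .out (.var 1)) (.var 0)) (.var 0)))))
  | select (l : Label) (L : Finset Label) (F : Label → Ty) (h : l ∈ L) :
      ConstTy (.select l (.choice .int L F)) (.arrow (.choice .int L F) (F l))
  | close : ConstTy .close (.arrow .fin .unit)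
  | fork : ConstTy .fork (.arrow (.arrow .unit .unit) .unit)
  | new : ConstTy .new (.all .S (.pair (.var 0) (.dual (.var 0))))

mutual
/-- Terms. `lam` and `fix` (the construct `rec x : A. v`) bind the term variable `0`, `tlam` binds
the type variable `0`, and `letRec [l₁, …, lₙ] t u` is `let {l₁ = x₁, …, lₙ = xₙ} = t in u`, where
`xᵢ` is the term variable `i - 1` of `u`. -/
inductive Term where
  | const (c : TmConst)
  | var (x : ℕ)
  | lam (A : Ty) (t : Term)
  | fix (A : Ty) (v : Term)
  | tlam (κ : Kind) (v : Term)
  | record (fs : Fields)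
  | variant (l : Label) (t : Term) (A : Ty)
  | app (t u : Term)
  | tapp (t : Term) (A : Ty)
  | letRec (ls : List Label) (t u : Term)
  | caseOf (t u : Term)
  | matchOn (t u : Term)

/-- The fields `l₁ = t₁, …, lₙ = tₙ` of a record term, in the order in which they are written. -/
inductive Fields where
  | nil
  | cons (l : Label) (t : Term) (fs : Fields)
end

def Fields.labels : Fields → List Label
  | .nil => []
  | .cons l _ fs => l :: fs.labels

/-- Pass a renaming of term variables under `n` binders. -/
def upRen (n : ℕ) (ρ : ℕ → ℕ) (i : ℕ) : ℕ := if i < n then i else ρ (i - n) + n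

mutual
/-- Renaming of the free term variables. -/
def Term.rename (ρ : ℕ → ℕ) : Term → Term
  | .const c => .const c
  | .var x => .var (ρ x)
  | .lam A t => .lam A (t.rename (upRen 1 ρ))
  | .fix A v => .fix A (v.rename (upRen 1 ρ))
  | .tlam κ v => .tlam κ (v.rename ρ)
  | .record fs => .record (fs.rename ρ)
  | .variant l t A => .variant l (t.rename ρ) A
  | .app t u => .app (t.rename ρ) (u.rename ρ)
  | .tapp t A => .tapp (t.rename ρ) A
  | .letRec ls t u => .letRec ls (t.rename ρ) (u.rename (upRen ls.length ρ))
  | .caseOf t u => .caseOf (t.rename ρ) (u.rename ρ)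
  | .matchOn t u => .matchOn (t.rename ρ) (u.rename ρ)

def Fields.rename (ρ : ℕ → ℕ) : Fields → Fields
  | .nil => .nil
  | .cons l t fs => .cons l (t.rename ρ) (fs.rename ρ)
end

mutual
inductive IsValue : Term → Prop
  | const (c : TmConst) : IsValue (.const c)
  | var (x : ℕ) : IsValue (.var x)
  | lam (A : Ty) (t : Term) : IsValue (.lam A t)
  | fix (A : Ty) {v : Term} (h : IsValue v) : IsValue (.fix A v)
  | tlam (κ : Kind) {v : Term} (h : IsValue v) : IsValue (.tlam κ v)
  | record {fs : Fields} (h : AreValues fs) : IsValue (.record fs)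
  | variant (l : Label) {v : Term} (A : Ty) (h : IsValue v) : IsValue (.variant l v A)
  | receive1 (A : Ty) : IsValue (.tapp (.const .receive) A)
  | receive2 (A B : Ty) : IsValue (.tapp (.tapp (.const .receive) A) B)
  | send1 (A : Ty) : IsValue (.tapp (.const .send) A)
  | send2 (A : Ty) {v : Term} (h : IsValue v) : IsValue (.app (.tapp (.const .send) A) v)
  | send3 (A : Ty) {v : Term} (B : Ty) (h : IsValue v) :
      IsValue (.tapp (.app (.tapp (.const .send) A) v) B)

inductive AreValues : Fields → Prop
  | nil : AreValues .nil
  | cons (l : Label) {v : Term} {fs : Fields} (h : IsValue v) (hs : AreValues fs) :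
      AreValues (.cons l v fs)
end

mutual
/-- `EvalPos e t` says that `t = E[e]` for some call-by-value evaluation context `E`. -/
inductive EvalPos : Term → Term → Prop
  | hole (e : Term) : EvalPos e e
  | appL {e t : Term} (u : Term) (h : EvalPos e t) : EvalPos e (.app t u)
  | appR {e t v : Term} (hv : IsValue v) (h : EvalPos e t) : EvalPos e (.app v t)
  | tapp {e t : Term} (A : Ty) (h : EvalPos e t) : EvalPos e (.tapp t A)
  | record {e : Term} {fs : Fields} (h : EvalPosF e fs) : EvalPos e (.record fs)
  | letRec {e t : Term} (ls : List Label) (u : Term) (h : EvalPos e t) :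
      EvalPos e (.letRec ls t u)
  | variant {e t : Term} (l : Label) (A : Ty) (h : EvalPos e t) : EvalPos e (.variant l t A)
  | caseOf {e t : Term} (u : Term) (h : EvalPos e t) : EvalPos e (.caseOf t u)
  | matchOn {e t : Term} (u : Term) (h : EvalPos e t) : EvalPos e (.matchOn t u)

inductive EvalPosF : Term → Fields → Prop
  | head {e t : Term} (l : Label) (fs : Fields) (h : EvalPos e t) : EvalPosF e (.cons l t fs)
  | tail {e v : Term} {fs : Fields} (l : Label) (hv : IsValue v) (h : EvalPosF e fs) :
      EvalPosF e (.cons l v fs)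
end

/-- Processes. `nu p` is `(ν x y) p`, where `x` is the term variable `0` and `y` the term variable
`1` of `p`. -/
inductive Proc where
  | thread (t : Term)
  | par (p q : Proc)
  | nu (p : Proc)

def Proc.rename (ρ : ℕ → ℕ) : Proc → Proc
  | .thread t => .thread (t.rename ρ)
  | .par p q => .par (p.rename ρ) (q.rename ρ)
  | .nu p => .nu (p.rename (upRen 2 ρ))

/-- Exchange the variables of two adjacent channel binders. -/
def swapNu : ℕ → ℕ
  | 0 => 2
  | 1 => 3
  | 2 => 0
  | 3 => 1
  | n => n

/-- Structural congruence. -/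
inductive Cong : Proc → Proc → Prop
  | refl (p : Proc) : Cong p p
  | symm {p q : Proc} (h : Cong p q) : Cong q p
  | trans {p q r : Proc} (h : Cong p q) (h' : Cong q r) : Cong p r
  | par {p p' q q' : Proc} (h : Cong p p') (h' : Cong q q') : Cong (.par p q) (.par p' q')
  | nu {p p' : Proc} (h : Cong p p') : Cong (.nu p) (.nu p')
  | comm (p q : Proc) : Cong (.par p q) (.par q p)
  | assoc (p q r : Proc) : Cong (.par (.par p q) r) (.par p (.par q r))
  | extrude (p q : Proc) : Cong (.par (.nu p) q) (.nu (.par p (q.rename (· + 2))))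
  | swap (p : Proc) : Cong (.nu (.nu p)) (.nu (.nu (p.rename swapNu)))

/-! ### Typing -/

/-- A binding of a term variable: linear `x : A` or unrestricted `x :^ω A`. -/
inductive Bind where
  | lin (A : Ty)
  | unr (A : Ty)

def Bind.ty : Bind → Ty
  | .lin A => A
  | .unr A => A

def Bind.shift : Bind → Bind
  | .lin A => .lin A.shift
  | .unr A => .unr A.shift

/-- Typing contexts, as partial maps from term variables to bindings. Derivable judgements have
contexts of finite domain. -/
def Ctx := ℕ → Option Bind

namespace Ctx

def empty : Ctx := fun _ => none

/-- Set or remove the binding of `x`. -/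
def set (Γ : Ctx) (x : ℕ) (b : Option Bind) : Ctx := fun i => if i = x then b else Γ i

/-- The context whose only binding is `x ↦ b`. -/
def single (x : ℕ) (b : Bind) : Ctx := empty.set x (some b)

/-- Extend the context with bindings `bs` for the term variables `0, …, bs.length - 1`. -/
def extend (bs : List Bind) (Γ : Ctx) : Ctx :=
  fun i => if i < bs.length then bs[i]? else Γ (i - bs.length)

/-- Weakening of all types in the context by one fresh type variable. -/
def shift (Γ : Ctx) : Ctx := fun i => (Γ i).map Bind.shift

/-- `Γ` is the disjoint union `Γ₁, Γ₂`. -/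
def Split (Γ Γ₁ Γ₂ : Ctx) : Prop :=
  ∀ i, (Γ₁ i = Γ i ∧ Γ₂ i = none) ∨ (Γ₁ i = none ∧ Γ₂ i = Γ i)

/-- All types in the context are session types, that is, closed types of kind `S`. -/
def Session (Γ : Ctx) : Prop := ∀ x b, Γ x = some b → Kinding [] b.ty .S

end Ctx

mutual
/-- Term typing `Δ ∣ Γ ⊢ t : A`. -/
inductive HasType : List Kind → Ctx → Term → Ty → Prop
  | const {Δ : List Kind} {c : TmConst} {A : Ty} (hc : ConstTy c A) (hA : ProperTy Δ A) :
      HasType Δ .empty (.const c) A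
  | var (Δ : List Kind) (x : ℕ) (A : Ty) : HasType Δ (.single x (.lin A)) (.var x) A
  | abs {Δ : List Kind} {Γ : Ctx} {A B : Ty} {t : Term} (hA : ProperTy Δ A)
      (ht : HasType Δ (Γ.extend [.lin A]) t B) : HasType Δ Γ (.lam A t) (.arrow A B)
  | app {Δ : List Kind} {Γ Γ₁ Γ₂ : Ctx} {A B : Ty} {t u : Term} (hΓ : Γ.Split Γ₁ Γ₂)
      (ht : HasType Δ Γ₁ t (.arrow A B)) (hu : HasType Δ Γ₂ u A) : HasType Δ Γ (.app t u) B
  | fix {Δ : List Kind} {Γ : Ctx} {A B : Ty} {v : Term} (hv : IsValue v) (hA : ProperTy Δ A)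
      (ht : HasType Δ (Γ.extend [.unr (.arrow A B)]) v (.arrow A B)) :
      HasType Δ Γ (.fix (.arrow A B) v) (.arrow A B)
  | tabs {Δ : List Kind} {Γ : Ctx} {κ : Kind} {A : Ty} {v : Term} (hv : IsValue v)
      (ht : HasType (κ :: Δ) Γ.shift v (.app A.shift (.var 0))) :
      HasType Δ Γ (.tlam κ v) (.app (.const (.all κ)) A)
  | tapp {Δ : List Kind} {Γ : Ctx} {κ : Kind} {A B : Ty} {t : Term}
      (ht : HasType Δ Γ t (.app (.const (.all κ)) A)) (hB : Kinding Δ B κ) :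
      HasType Δ Γ (.tapp t B) (.app A B)
  | record {Δ : List Kind} {Γ : Ctx} {fs : Fields} {F : Label → Ty} (hl : fs.labels.Nodup)
      (ht : FieldsType Δ Γ fs F) : HasType Δ Γ (.record fs) (.record fs.labels.toFinset F)
  | proj {Δ : List Kind} {Γ Γ₁ Γ₂ : Ctx} {ls : List Label} {F : Label → Ty} {B : Ty}
      {t u : Term} (hl : ls.Nodup) (hΓ : Γ.Split Γ₁ Γ₂)
      (ht : HasType Δ Γ₁ t (.record ls.toFinset F))
      (hu : HasType Δ (Γ₂.extend (ls.map (fun l => .lin (F l)))) u B) :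
      HasType Δ Γ (.letRec ls t u) B
  | variant {Δ : List Kind} {Γ : Ctx} {l : Label} {L : Finset Label} {F : Label → Ty} {t : Term}
      (hl : l ∈ L) (hA : ProperTy Δ (.variant L F)) (ht : HasType Δ Γ t (F l)) :
      HasType Δ Γ (.variant l t (.variant L F)) (.variant L F)
  | caseOf {Δ : List Kind} {Γ Γ₁ Γ₂ : Ctx} {L : Finset Label} {F : Label → Ty} {B : Ty}
      {t u : Term} (hΓ : Γ.Split Γ₁ Γ₂) (ht : HasType Δ Γ₁ t (.variant L F))
      (hu : HasType Δ Γ₂ u (.record L (fun l => .arrow (F l) B))) : HasType Δ Γ (.caseOf t u) B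
  | matchOn {Δ : List Kind} {Γ Γ₁ Γ₂ : Ctx} {L : Finset Label} {F : Label → Ty} {B : Ty}
      {t u : Term} (hΓ : Γ.Split Γ₁ Γ₂) (ht : HasType Δ Γ₁ t (.choice .ext L F))
      (hu : HasType Δ Γ₂ u (.record L (fun l => .arrow (F l) B))) : HasType Δ Γ (.matchOn t u) B
  | eq {Δ : List Kind} {Γ : Ctx} {A B : Ty} {t : Term} (ht : HasType Δ Γ t A)
      (hA : ProperTy Δ A) (h : Bisim A B) : HasType Δ Γ t B
  | dereliction {Δ : List Kind} {Γ : Ctx} {x : ℕ} {A B : Ty} {t : Term}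
      (hx : Γ x = some (.lin A)) (ht : HasType Δ Γ t B) :
      HasType Δ (Γ.set x (some (.unr A))) t B
  | weakening {Δ : List Kind} {Γ : Ctx} {x : ℕ} {B : Ty} {t : Term} (A : Ty)
      (hx : Γ x = none) (ht : HasType Δ Γ t B) : HasType Δ (Γ.set x (some (.unr A))) t B
  | contraction {Δ : List Kind} {Γ : Ctx} {x y : ℕ} {A B : Ty} {t : Term} (hxy : x ≠ y)
      (hx : Γ x = some (.unr A)) (hy : Γ y = some (.unr A)) (ht : HasType Δ Γ t B) :
      HasType Δ (Γ.set y none) (t.rename (fun i => if i = y then x else i)) B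

/-- The field of label `l` has type `F l`, and the context is split between the fields. -/
inductive FieldsType : List Kind → Ctx → Fields → (Label → Ty) → Prop
  | nil (Δ : List Kind) (F : Label → Ty) : FieldsType Δ .empty .nil F
  | cons {Δ : List Kind} {Γ Γ₁ Γ₂ : Ctx} {l : Label} {t : Term} {fs : Fields} {F : Label → Ty}
      (hΓ : Γ.Split Γ₁ Γ₂) (ht : HasType Δ Γ₁ t (F l)) (hs : FieldsType Δ Γ₂ fs F) :
      FieldsType Δ Γ (.cons l t fs) F
end

/-- Process typing. The two ends of a channel have types `A` and `Dual A`, for a session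
type `A`. -/
inductive ProcType : Ctx → Proc → Prop
  | thread {Γ : Ctx} {t : Term} (h : HasType [] Γ t .unit) : ProcType Γ (.thread t)
  | par {Γ Γ₁ Γ₂ : Ctx} {p q : Proc} (hΓ : Γ.Split Γ₁ Γ₂) (hp : ProcType Γ₁ p)
      (hq : ProcType Γ₂ q) : ProcType Γ (.par p q)
  | nu {Γ : Ctx} {A : Ty} {p : Proc} (hA : Kinding [] A .S)
      (hp : ProcType (Γ.extend [.lin A, .lin (.dual A)]) p) : ProcType Γ (.nu p)

/-! ### Runtime errors -/

mutual
/-- `SubAt k e t` says that `e` is a subexpression of `t` in the scope of `k` term variables bound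
inside `t`; in `e` these are the variables `0, …, k - 1`. -/
inductive SubAt : ℕ → Term → Term → Prop
  | refl (e : Term) : SubAt 0 e e
  | lam {k : ℕ} {e t : Term} (A : Ty) (h : SubAt k e t) : SubAt (k + 1) e (.lam A t)
  | fix {k : ℕ} {e v : Term} (A : Ty) (h : SubAt k e v) : SubAt (k + 1) e (.fix A v)
  | tlam {k : ℕ} {e v : Term} (κ : Kind) (h : SubAt k e v) : SubAt k e (.tlam κ v)
  | record {k : ℕ} {e : Term} {fs : Fields} (h : SubAtF k e fs) : SubAt k e (.record fs)
  | variant {k : ℕ} {e t : Term} (l : Label) (A : Ty) (h : SubAt k e t) :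
      SubAt k e (.variant l t A)
  | appL {k : ℕ} {e t : Term} (u : Term) (h : SubAt k e t) : SubAt k e (.app t u)
  | appR {k : ℕ} {e u : Term} (t : Term) (h : SubAt k e u) : SubAt k e (.app t u)
  | tapp {k : ℕ} {e t : Term} (A : Ty) (h : SubAt k e t) : SubAt k e (.tapp t A)
  | letRecL {k : ℕ} {e t : Term} (ls : List Label) (u : Term) (h : SubAt k e t) :
      SubAt k e (.letRec ls t u)
  | letRecR {k : ℕ} {e u : Term} (ls : List Label) (t : Term) (h : SubAt k e u) :
      SubAt (k + ls.length) e (.letRec ls t u)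
  | caseOfL {k : ℕ} {e t : Term} (u : Term) (h : SubAt k e t) : SubAt k e (.caseOf t u)
  | caseOfR {k : ℕ} {e u : Term} (t : Term) (h : SubAt k e u) : SubAt k e (.caseOf t u)
  | matchOnL {k : ℕ} {e t : Term} (u : Term) (h : SubAt k e t) : SubAt k e (.matchOn t u)
  | matchOnR {k : ℕ} {e u : Term} (t : Term) (h : SubAt k e u) : SubAt k e (.matchOn t u)

inductive SubAtF : ℕ → Term → Fields → Prop
  | head {k : ℕ} {e t : Term} (l : Label) (fs : Fields) (h : SubAt k e t) :
      SubAtF k e (.cons l t fs)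
  | tail {k : ℕ} {e : Term} {fs : Fields} (l : Label) (t : Term) (h : SubAtF k e fs) :
      SubAtF k e (.cons l t fs)
end

/-- `SubProc q p` says that `q` is a subprocess of `p`. -/
inductive SubProc : Proc → Proc → Prop
  | refl (p : Proc) : SubProc p p
  | parL {q p₁ : Proc} (p₂ : Proc) (h : SubProc q p₁) : SubProc q (.par p₁ p₂)
  | parR {q p₂ : Proc} (p₁ : Proc) (h : SubProc q p₂) : SubProc q (.par p₁ p₂)
  | nu {q p : Proc} (h : SubProc q p) : SubProc q (.nu p)

/-- `v` is a term variable bound inside the surrounding term. -/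
def BoundVar (k : ℕ) (v : Term) : Prop := ∃ i < k, v = .var i

/-- Values that may be applied to a value. -/
inductive AppHead : Term → Prop
  | lam (A : Ty) (t : Term) : AppHead (.lam A t)
  | fix (A : Ty) (v : Term) : AppHead (.fix A v)
  | receive (A B : Ty) : AppHead (.tapp (.tapp (.const .receive) A) B)
  | send1 (A : Ty) : AppHead (.tapp (.const .send) A)
  | send3 (A : Ty) (v : Term) (B : Ty) : AppHead (.tapp (.app (.tapp (.const .send) A) v) B)
  | select (l : Label) (A : Ty) : AppHead (.const (.select l A))
  | close : AppHead (.const .close)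
  | fork : AppHead (.const .fork)

/-- Values that may be applied to a type. -/
inductive TAppHead : Term → Prop
  | tlam (κ : Kind) (v : Term) : TAppHead (.tlam κ v)
  | receive : TAppHead (.const .receive)
  | receive1 (A : Ty) : TAppHead (.tapp (.const .receive) A)
  | send : TAppHead (.const .send)
  | send2 (A : Ty) (v : Term) : TAppHead (.app (.tapp (.const .send) A) v)
  | new : TAppHead (.const .new)

/-- `SessionOp e t` says that `e` is a session operation applied to the term `t`. -/
inductive SessionOp : Term → Term → Prop
  | receive (A B : Ty) (t : Term) : SessionOp (.app (.tapp (.tapp (.const .receive) A) B) t) t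
  | send (A : Ty) {v : Term} (B : Ty) (t : Term) (hv : IsValue v) :
      SessionOp (.app (.tapp (.app (.tapp (.const .send) A) v) B) t) t
  | matchOn (t u : Term) : SessionOp (.matchOn t u) t
  | select (l : Label) (A : Ty) (t : Term) : SessionOp (.app (.const (.select l A)) t) t
  | close (t : Term) : SessionOp (.app (.const .close) t) t

/-- The subject of a session operation on a variable. -/
def Subj (e : Term) (x : ℕ) : Prop := SessionOp e (.var x)

/-- `BadExpr k e` says that the expression `e`, found in the scope of `k` bound term variables, is
erroneous. -/
inductive BadExpr (k : ℕ) : Term → Prop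
  | app {v u : Term} (hv : IsValue v) (hu : IsValue u) (hb : ¬ BoundVar k v) (h : ¬ AppHead v) :
      BadExpr k (.app v u)
  | tapp {v : Term} (A : Ty) (hv : IsValue v) (hb : ¬ BoundVar k v) (h : ¬ TAppHead v) :
      BadExpr k (.tapp v A)
  | letRec {ls : List Label} {v : Term} (t : Term) (hv : IsValue v) (hb : ¬ BoundVar k v)
      (h : ∀ fs, v = .record fs → ¬ fs.labels.Perm ls) : BadExpr k (.letRec ls v t)
  /-- The scrutinee of a `case` is not a variant. -/
  | caseScrut {v : Term} (t : Term) (hv : IsValue v) (hb : ¬ BoundVar k v)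
      (h : ∀ l u A, v ≠ .variant l u A) : BadExpr k (.caseOf v t)
  /-- The branches of a `case` do not cover the label of the scrutinee. -/
  | caseLabel {l : Label} {u : Term} (A : Ty) {fs : Fields} (hu : IsValue u)
      (h : l ∉ fs.labels) : BadExpr k (.caseOf (.variant l u A) (.record fs))
  /-- The branches of a `case` are given by a value that is not a record. -/
  | caseBranches {v t : Term} (hv : IsValue v) (ht : IsValue t) (hb : ¬ BoundVar k t)
      (h : ∀ fs, t ≠ .record fs) : BadExpr k (.caseOf v t)
  | endpoint {e v : Term} (he : SessionOp e v) (hv : IsValue v) (h : ∀ x, v ≠ .var x) :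
      BadExpr k e

/-- The term `t` offers the branch `l`: it is a record with a field `l`, or it has
still to be evaluated to a record. -/
def Offers (l : Label) (t : Term) : Prop :=
  (∃ fs, t = .record fs ∧ l ∈ fs.labels) ∨ (¬ IsValue t ∧ ∀ fs, t ≠ .record fs)

/-- Two session operations agree on the channel with ends `x` and `y`. -/
inductive Agree (x y : ℕ) : Term → Term → Prop
  | receiveSend (A B : Ty) (C : Ty) {v : Term} (D : Ty) (hv : IsValue v) :
      Agree x y (.app (.tapp (.tapp (.const .receive) A) B) (.var x))
        (.app (.tapp (.app (.tapp (.const .send) C) v) D) (.var y))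
  | sendReceive (A B : Ty) (C : Ty) {v : Term} (D : Ty) (hv : IsValue v) :
      Agree x y (.app (.tapp (.app (.tapp (.const .send) C) v) D) (.var x))
        (.app (.tapp (.tapp (.const .receive) A) B) (.var y))
  | close : Agree x y (.app (.const .close) (.var x)) (.app (.const .close) (.var y))
  | matchSelect {l : Label} {t : Term} (A : Ty) (h : Offers l t) :
      Agree x y (.matchOn (.var x) t) (.app (.const (.select l A)) (.var y))
  | selectMatch {l : Label} {t : Term} (A : Ty) (h : Offers l t) :
      Agree x y (.app (.const (.select l A)) (.var x)) (.matchOn (.var y) t)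

/-- The process contains an erroneous subexpression or subprocess. -/
inductive HasError (p : Proc) : Prop
  | expr {t e : Term} {k : ℕ} (ht : SubProc (.thread t) p) (he : SubAt k e t) (h : BadExpr k e)
  /-- Two threads use the same channel end. -/
  | sameEnd {t₁ t₂ e₁ e₂ : Term} {x : ℕ}
      (hp : SubProc (.par (.thread t₁) (.thread t₂)) p)
      (h₁ : EvalPos e₁ t₁) (h₂ : EvalPos e₂ t₂) (s₁ : Subj e₁ x) (s₂ : Subj e₂ x)
  /-- The operations on the two ends of a channel do not match. -/
  | mismatch {t₁ t₂ e₁ e₂ : Term}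
      (hp : SubProc (.nu (.par (.thread t₁) (.thread t₂))) p)
      (h₁ : EvalPos e₁ t₁) (h₂ : EvalPos e₂ t₂) (s₁ : Subj e₁ 0) (s₂ : Subj e₂ 1)
      (h : ¬ Agree 0 1 e₁ e₂)

/-- A process is a runtime error if it is structurally congruent to a process that contains an
erroneous subexpression or subprocess. -/
def RuntimeError (p : Proc) : Prop := ∃ q, Cong p q ∧ HasError q

end FMu

/-!
Every error is excluded by a comparison of the constants at the heads of types.

Heads. A type has at most one head. Since `TyRed` is neither deterministic nor confluent, heads are
computed by a deterministic abstract machine (`next`, `Ev`), whose states are a type and a stack of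
frames. A reduct and its source give the same head (`Ev.expand`; the overlapping reductions are
absorbed by the relation `Reassoc` on stacks), and each transition of a type exhibits its head
(`Step.ev`), so that the head is unique (`HasHead.unique`) and invariant under bisimilarity
(`HasHead.bisim`). A frame `Dual []` at the bottom of the stack dualises the head
(`Ev.dual_concat`), so that the two ends of a channel have dual heads (`HasHead.dual`). A kinding
argument on machine states shows that a session type is never headed by an arrow, a quantifier, a
record or a variant (`SessionTy.not_hasHead`).

Instantiation. Bisimilarity is not shown to be a congruence, nor is it needed. The types of
`receive` and `send` are described by sequences of labels that determine a constant or an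
abstraction. Such traces survive bisimilarity (`Trace.bisim`) and substitution (`Trace.subst`), so
they can be followed through type applications (`Trace.all_inst`) up to the point
where the head of the channel type appears.

Terms. Linearity matters only for the absence of two threads on one channel end. Terms are
therefore retyped in a system `Term.WT` without linearity, where inversion is built in and
renaming is harmless (`Term.wt_rename`); a value that is not a variable has the form that the head
of its type prescribes (`IsValue.canonical`), and a variable not bound in its thread has a session
type. This excludes all erroneous expressions (`Term.WT.not_badExpr`).

Processes. The relaxed typing `Proc.WT` keeps of linearity that parallel components share no free
variable. It is invariant under structural congruence (`Cong.wt_iff`), and it excludes two threads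
on one end as well as disagreeing operations on the two ends of a channel (`Expects.agree`).
-/

namespace FMu

/-! ### Substitution in types -/

namespace Ty

/-- Pass a substitution of type variables under a binder. -/
def up (σ : ℕ → Ty) : ℕ → Ty := fun n => Nat.casesOn n (var 0) (fun m => (σ m).shift)

theorem subst_lam (σ : ℕ → Ty) (κ : Kind) (A : Ty) :
    (lam κ A).subst σ = lam κ (A.subst (up σ)) := rfl

theorem rename_rename (A : Ty) (ρ ρ' : ℕ → ℕ) :
    (A.rename ρ).rename ρ' = A.rename (fun n => ρ' (ρ n)) := by
  induction A generalizing ρ ρ' with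
  | const | var => rfl
  | app _ _ hA hB => simp only [rename, hA, hB]
  | lam κ A hA =>
    simp only [rename, hA]
    congr 2
    funext n
    cases n <;> rfl

theorem rename_subst (A : Ty) (ρ : ℕ → ℕ) (σ : ℕ → Ty) :
    (A.rename ρ).subst σ = A.subst (fun n => σ (ρ n)) := by
  induction A generalizing ρ σ with
  | const | var => rfl
  | app _ _ hA hB => simp only [rename, subst, hA, hB]
  | lam κ A hA =>
    simp only [rename, subst, hA]
    congr 2
    funext n
    cases n <;> rfl

theorem subst_rename (A : Ty) (σ : ℕ → Ty) (ρ : ℕ → ℕ) :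
    (A.subst σ).rename ρ = A.subst (fun n => (σ n).rename ρ) := by
  induction A generalizing ρ σ with
  | const | var => rfl
  | app _ _ hA hB => simp only [rename, subst, hA, hB]
  | lam κ A hA =>
    simp only [rename, subst, hA]
    congr 2
    funext n
    cases n with
    | zero => rfl
    | succ m => simp only [shift, rename_rename]

theorem subst_subst (A : Ty) (σ τ : ℕ → Ty) :
    (A.subst σ).subst τ = A.subst (fun n => (σ n).subst τ) := by
  induction A generalizing σ τ with
  | const | var => rfl
  | app _ _ hA hB => simp only [subst, hA, hB]
  | lam κ A hA =>
    simp only [subst, hA]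
    congr 2
    funext n
    cases n with
    | zero => rfl
    | succ m => simp only [shift, rename_subst, subst_rename]

theorem subst_var (A : Ty) : A.subst var = A := by
  induction A with
  | const | var => rfl
  | app _ _ hA hB => simp only [subst, hA, hB]
  | lam κ A hA =>
    rw [subst_lam]
    have : up var = var := by
      funext n
      cases n <;> rfl
    rw [this, hA]

theorem inst_subst (A B : Ty) (σ : ℕ → Ty) :
    (A.inst B).subst σ = (A.subst (up σ)).inst (B.subst σ) := by
  simp only [inst, subst_subst]
  congr 1
  funext n
  cases n with
  | zero => rfl
  | succ m => simp only [up, shift, rename_subst, subst_var, subst]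

theorem apps_cons (A B : Ty) (Bs : List Ty) : apps A (B :: Bs) = apps (app A B) Bs := rfl

theorem apps_subst (A : Ty) (Bs : List Ty) (σ : ℕ → Ty) :
    (apps A Bs).subst σ = apps (A.subst σ) (Bs.map (subst σ)) := by
  induction Bs generalizing A with
  | nil => rfl
  | cons B Bs ih => simp only [apps_cons, ih, List.map_cons, subst]

/-- The leftmost head of a type together with its arguments. -/
def spine : Ty → Ty × List Ty
  | app A B => (A.spine.1, A.spine.2 ++ [B])
  | A => (A, [])

theorem spine_apps (A : Ty) (Bs : List Ty) :
    (apps A Bs).spine = (A.spine.1, A.spine.2 ++ Bs) := by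
  induction Bs generalizing A with
  | nil => simp [apps]
  | cons B Bs ih => simp [apps_cons, ih, spine]

end Ty

/-! ### Weak head evaluation -/

/-- The constant that takes the place of `ι` below `Dual`. -/
def TConst.flip : TConst → TConst
  | .msg s => .msg s.dual
  | .choice v L => .choice v.dual L
  | ι => ι

/-- The head of a weak head normal form, looked up below the contexts `[]; B` and `Dual []`. A
message or a choice below `Dual` is replaced by its dual, and types whose head is
a type variable are not distinguished. -/
inductive Head where
  | const (ι : TConst)
  | lam
  | neutral

def Head.flip : Head → Head
  | .const ι => .const ι.flip
  | h => h

/-- The frames of the contexts in which reduction takes place: `[] B`, `[]; B` and `Dual []`. -/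
inductive Frame where
  | app (B : Ty)
  | seq (B : Ty)
  | dual

/-- The number of frames `Dual []` in a stack. -/
def duals : List Frame → ℕ
  | [] => 0
  | .dual :: K => duals K + 1
  | .app _ :: K => duals K
  | .seq _ :: K => duals K

/-- One transition of an abstract machine that reduces the type in the hole of the context given by
a stack of frames, innermost frame first. In contrast with `TyRed` it is deterministic. -/
def next : Ty → List Frame → Option (Ty × List Frame)
  | .app A B, K => some (A, .app B :: K)
  | .lam _ A, .app B :: K => some (A.inst B, K)
  | .const (.mu κ), .app A :: K => some (A, .app (.app (.const (.mu κ)) A) :: K)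
  | .const .seq, .app A :: .app B :: K => some (A, .seq B :: K)
  | .const .dual, .app A :: K => some (A, .dual :: K)
  | .const .skip, .seq B :: K => some (B, K)
  | .const .skip, .dual :: K => some (.const .skip, K)
  | _, _ => none

/-- The head read off from a machine state without a transition. -/
def out : Ty → List Frame → Head
  | .const ι, K => .const (TConst.flip^[duals K] ι)
  | .lam _ _, _ => .lam
  | _, _ => .neutral

/-- The machine started on `A` and the stack `K` halts with the head `h`. -/
inductive Ev : Ty → List Frame → Head → Prop
  | step {A A' : Ty} {K K' : List Frame} {h : Head} (hn : next A K = some (A', K'))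
      (he : Ev A' K' h) : Ev A K h
  | halt {A : Ty} {K : List Frame} (hn : next A K = none) : Ev A K (out A K)

theorem ev_iff {A A' : Ty} {K K' : List Frame} {h : Head} (hn : next A K = some (A', K')) :
    Ev A K h ↔ Ev A' K' h := by
  refine ⟨fun he => ?_, .step hn⟩
  cases he with
  | step hn' he =>
    rw [hn] at hn'
    cases hn'
    exact he
  | halt hn' => simp [hn] at hn'

theorem ev_of_next_eq_none {A : Ty} {K : List Frame} {h : Head} (hn : next A K = none)
    (he : Ev A K h) : h = out A K := by
  cases he with
  | step hn' he => simp [hn] at hn'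
  | halt => rfl

theorem Ev.unique {A : Ty} {K : List Frame} {h h' : Head} (he : Ev A K h) (he' : Ev A K h') :
    h = h' := by
  induction he with
  | step hn _ ih => exact ih ((ev_iff hn).1 he')
  | halt hn => exact (ev_of_next_eq_none hn he').symm

theorem ev_app {A B : Ty} {K : List Frame} {h : Head} :
    Ev (.app A B) K h ↔ Ev A (.app B :: K) h := ev_iff rfl

theorem ev_seq {A B : Ty} {K : List Frame} {h : Head} :
    Ev (.seq A B) K h ↔ Ev A (.seq B :: K) h :=
  ev_app.trans (ev_app.trans (ev_iff rfl))

theorem ev_dual {A : Ty} {K : List Frame} {h : Head} :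
    Ev (.dual A) K h ↔ Ev A (.dual :: K) h := ev_app.trans (ev_iff rfl)

theorem ev_skip_seq {B : Ty} {K : List Frame} {h : Head} :
    Ev .skip (.seq B :: K) h ↔ Ev B K h := ev_iff rfl

theorem ev_skip_dual {K : List Frame} {h : Head} :
    Ev .skip (.dual :: K) h ↔ Ev .skip K h := ev_iff rfl

theorem ev_apps {A : Ty} {Bs : List Ty} {K : List Frame} {h : Head} :
    Ev (Ty.apps A Bs) K h ↔ Ev A (Bs.map Frame.app ++ K) h := by
  induction Bs generalizing A with
  | nil => rfl
  | cons B Bs ih =>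
    rw [Ty.apps_cons, ih, ev_app]
    rfl

theorem ev_var {a : ℕ} {K : List Frame} {h : Head} : Ev (.var a) K h ↔ h = .neutral :=
  ⟨ev_of_next_eq_none rfl, by rintro rfl; exact .halt rfl⟩

theorem duals_args (As : List Ty) (K : List Frame) : duals (As.map Frame.app ++ K) = duals K := by
  induction As with
  | nil => rfl
  | cons A As ih => simpa [duals] using ih

theorem ev_msg {s : Pol} {K : List Frame} {h : Head} :
    Ev (.const (.msg s)) K h ↔ h = .const (TConst.flip^[duals K] (.msg s)) :=
  ⟨ev_of_next_eq_none rfl, by rintro rfl; exact .halt rfl⟩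

theorem ev_choice {v : View} {L : Finset Label} {K : List Frame} {h : Head} :
    Ev (.const (.choice v L)) K h ↔ h = .const (TConst.flip^[duals K] (.choice v L)) :=
  ⟨ev_of_next_eq_none rfl, by rintro rfl; exact .halt rfl⟩

theorem ev_fin {K : List Frame} {h : Head} :
    Ev .fin K h ↔ h = .const (TConst.flip^[duals K] .fin) :=
  ⟨ev_of_next_eq_none rfl, by rintro rfl; exact .halt rfl⟩

/-- The stacks that differ by the reductions `(A; B); C ⟶ A; (B; C)` and
`Dual (A; B) ⟶ Dual A; Dual B`, with the stack of the reduct on the left. These reductions overlap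
with the reductions inside `A`, and the overlaps are not joinable, since no reduction takes place to
the right of a semicolon. -/
inductive Reassoc : List Frame → List Frame → Prop
  | nil : Reassoc [] []
  | cons (f : Frame) {K K' : List Frame} (h : Reassoc K K') : Reassoc (f :: K) (f :: K')
  | assoc (B C : Ty) {K K' : List Frame} (h : Reassoc K K') :
      Reassoc (.seq (.seq B C) :: K) (.seq B :: .seq C :: K')
  | dual (B : Ty) {K K' : List Frame} (h : Reassoc K K') :
      Reassoc (.dual :: .seq (.dual B) :: K) (.seq B :: .dual :: K')

theorem Reassoc.refl (K : List Frame) : Reassoc K K := by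
  induction K with
  | nil => exact .nil
  | cons f K ih => exact .cons f ih

theorem Reassoc.duals_eq {K K' : List Frame} (h : Reassoc K K') : duals K = duals K' := by
  induction h with
  | nil => rfl
  | cons f _ ih => cases f <;> simp [duals, ih]
  | assoc _ _ _ ih => simp [duals, ih]
  | dual _ _ ih => simp [duals, ih]

/-- Each transition from the left stack is matched by a run from the right one; the two sides come
apart only at `Skip`, and meet again after a few transitions. -/
theorem Ev.reassoc {A : Ty} {K K' : List Frame} {h : Head} (he : Ev A K h) (hK : Reassoc K K') :
    Ev A K' h := by
  induction he generalizing K' with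
  | @step A A' K₁ K₂ h hn he ih =>
    unfold next at hn
    split at hn <;> cases hn
    · exact .step rfl (ih (.cons _ hK))
    · cases hK with
      | cons _ hK => exact .step rfl (ih hK)
    · cases hK with
      | cons _ hK => exact .step rfl (ih (.cons _ hK))
    · cases hK with
      | cons _ hK =>
        cases hK with
        | cons _ hK => exact .step rfl (ih (.cons _ hK))
    · cases hK with
      | cons _ hK => exact .step rfl (ih (.cons _ hK))
    · cases hK with
      | cons _ hK => exact .step rfl (ih hK)
      | assoc B C hK =>
        -- `Skip` below both stacks leads to `B` below `[]; C`.
        exact ev_skip_seq.2 (ev_seq.1 (ih hK))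
    · cases hK with
      | cons _ hK => exact .step rfl (ih hK)
      | dual B hK =>
        -- `Skip` below both stacks leads to `B` below `Dual []`.
        exact ev_skip_seq.2 (ev_dual.1 (ev_skip_seq.1 (ih (.cons _ hK))))
  | @halt A K hn =>
    have hout : out A K = out A K' := by cases A <;> simp [out, hK.duals_eq]
    rw [hout]
    refine .halt ?_
    cases A with
    | var => rfl
    | app => cases hn
    | lam κ A => cases hK with
      | cons f _ => cases f <;> first | rfl | cases hn
      | _ => rfl
    | const ι =>
      cases ι <;> first
        | rfl
        | (cases hK with
            | nil => rfl
            | cons f hK => cases f <;> first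
                | rfl
                | cases hn
                | (cases hK with
                    | nil => rfl
                    | cons f hK => cases f <;> first | rfl | cases hn
                    | _ => rfl)
            | _ => first | rfl | cases hn)

/-- A type gives the head of its reducts, in every stack. -/
theorem Ev.expand {A B : Ty} {K : List Frame} {h : Head} (hr : TyRed A B) (he : Ev B K h) :
    Ev A K h := by
  induction hr generalizing K with
  | seq1 A => exact ev_seq.2 (ev_skip_seq.2 he)
  | seq2 B _ ih => exact ev_seq.2 (ih (ev_seq.1 he))
  | assoc A B C =>
    exact ev_seq.2 (ev_seq.2 ((ev_seq.1 he).reassoc (.assoc B C (.refl K))))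
  | mu κ A => exact ev_app.2 (.step rfl (ev_app.1 he))
  | beta κ A B => exact ev_app.2 (.step rfl he)
  | tappL B _ ih => exact ev_app.2 (ih (ev_app.1 he))
  | dualSeq A B =>
    exact ev_dual.2 (ev_seq.2 ((ev_dual.1 (ev_seq.1 he)).reassoc (.dual B (.refl K))))
  | dualSkip => exact ev_dual.2 (ev_skip_dual.2 he)
  | dualFin =>
    rw [ev_dual, ev_fin]
    rw [ev_fin] at he
    simpa [duals, TConst.flip] using he
  | dualMsg s A =>
    rw [ev_dual, Ty.msg, ev_app, ev_msg]
    rw [Ty.msg, ev_app, ev_msg] at he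
    simpa [duals, TConst.flip] using he
  | dualChoice v L As h =>
    rw [ev_dual, ev_apps, ev_choice, duals_args]
    rw [ev_apps, ev_choice, duals_args] at he
    simpa [duals, TConst.flip] using he
  | dualCtx _ ih => exact ev_dual.2 (ih (ev_dual.1 he))
  | dualDualVar a As =>
    rw [ev_dual, ev_dual, ev_apps, ev_var]
    rwa [ev_apps, ev_var] at he

/-- `Dual` exchanges the heads. -/
theorem Ev.dual_concat {A : Ty} {K : List Frame} {h : Head} (he : Ev A K h) :
    Ev A (K ++ [.dual]) h.flip := by
  induction he with
  | @step A A' K K' h hn _ ih =>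
    refine .step ?_ ih
    unfold next at hn
    split at hn <;> cases hn <;> rfl
  | @halt A K hn =>
    have hd : duals (K ++ [.dual]) = duals K + 1 := by
      clear hn
      induction K with
      | nil => rfl
      | cons f K ih => cases f <;> simp [duals, ih]
    have hout : (out A K).flip = out A (K ++ [.dual]) := by
      cases A <;> simp [out, Head.flip, hd, Function.iterate_succ_apply']
    rcases A with ι | a | ⟨κ, A⟩ | ⟨A, B⟩
    · by_cases hs : ι = .skip ∧ K = []
      · -- The only state in which the additional frame enables a transition.
        obtain ⟨rfl, rfl⟩ := hs
        exact ev_skip_dual.2 (.halt rfl)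
      · rw [hout]
        refine .halt ?_
        rcases K with _ | ⟨f, _ | ⟨g, K⟩⟩
        · cases ι <;> first | rfl | exact absurd ⟨rfl, rfl⟩ hs
        · cases ι <;> cases f <;> first | rfl | cases hn
        · cases ι <;> cases f <;> cases g <;> first | rfl | cases hn
    · rw [hout]
      exact .halt rfl
    · rw [hout]
      refine .halt ?_
      rcases K with _ | ⟨f, K⟩
      · rfl
      · cases f <;> first | rfl | cases hn
    · cases hn

/-! ### Heads and transitions -/

/-- The head of a type that has a transition with the given label. The labels `Dual₁` and `Dual₂`
come from `Dual (α A₁ ⋯ Aₘ)` only, whereas `Dual₀` comes from the constant `Dual`. -/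
def TLabel.head : TLabel → Head
  | .var _ _ => .neutral
  | .const .dual (_ + 1) => .neutral
  | .const ι _ => .const ι
  | .lam _ => .lam

theorem Transparent.head {ι : TConst} (hι : Transparent ι) (j : ℕ) :
    (TLabel.const ι j).head = .const ι := by
  cases hι <;> rfl

theorem Transparent.ev {ι : TConst} (hι : Transparent ι) (K : List Frame) :
    Ev (.const ι) K (.const (TConst.flip^[duals K] ι)) := by
  cases hι <;> exact .halt rfl

theorem Step.ev {A B : Ty} {a : TLabel} (h : Step A a B) : Ev A [] a.head := by
  induction h with
  | red h _ ih => exact ih.expand h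
  | var1 a As | var2 a As => exact ev_apps.2 (ev_var.2 rfl)
  | const ι h => cases ι <;> exact .halt rfl
  | constApp ι As j B hι h =>
    rw [hι.head, ev_apps]
    have := hι.ev (As.map Frame.app ++ [])
    rwa [duals_args] at this
  | lam κ A => exact .halt rfl
  | msg1 s A | msg2 s A => exact ev_app.2 (.halt rfl)
  | seq1 A => exact ev_app.2 (.halt rfl)
  | varSeq1 a As | varSeq2 a As => exact ev_seq.2 (ev_apps.2 (ev_var.2 rfl))
  | msgSeq1 s A | msgSeq2 s A => exact ev_seq.2 (ev_app.2 (.halt rfl))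
  | choiceSeq v L As B hl j C h =>
    rw [ev_seq, ev_apps, ev_choice, duals_args]
    rfl
  | finSeq B => exact ev_seq.2 (ev_fin.2 rfl)
  | dualVar1 a As | dualVar2 a As => exact ev_dual.2 (ev_apps.2 (ev_var.2 rfl))
  | dualSeq1 a As | dualSeq2 a As => exact ev_seq.2 (ev_dual.2 (ev_apps.2 (ev_var.2 rfl)))

/-! ### Rigid transitions under substitution -/

/-- A reduction to a type whose head is not a type variable is preserved by substitution. The
reduction `Dual (Dual (α A₁ ⋯ Aₘ)) ⟶ α A₁ ⋯ Aₘ` is not. -/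
theorem TyRed.subst {A B : Ty} {K : List Frame} {h : Head} (hr : TyRed A B) (he : Ev B K h)
    (hh : h ≠ .neutral) (σ : ℕ → Ty) : TyRed (A.subst σ) (B.subst σ) := by
  induction hr generalizing K with
  | seq1 A => exact .seq1 _
  | seq2 B _ ih => exact .seq2 _ (ih (ev_seq.1 he))
  | assoc A B C => exact .assoc _ _ _
  | mu κ A => exact .mu _ _
  | beta κ A B =>
    rw [Ty.inst_subst]
    exact .beta _ _ _
  | tappL B _ ih => exact .tappL _ (ih (ev_app.1 he))
  | dualSeq A B => exact .dualSeq _ _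
  | dualSkip => exact .dualSkip
  | dualFin => exact .dualFin
  | dualMsg s A => exact .dualMsg _ _
  | dualChoice v L As h =>
    have := TyRed.dualChoice v L (As.map (Ty.subst σ)) (by simpa using h)
    simpa [Ty.apps_subst, Ty.dual, Ty.subst, Function.comp_def] using this
  | dualCtx _ ih => exact .dualCtx (ih (ev_dual.1 he))
  | dualDualVar a As =>
    rw [ev_apps, ev_var] at he
    exact absurd he hh

/-- The target is substituted with `σ`, or with `up σ` if the transition enters an abstraction. -/
theorem Step.subst {A B : Ty} {a : TLabel} (h : Step A a B) (ha : a.head ≠ .neutral)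
    (σ : ℕ → Ty) : ∃ τ, Step (A.subst σ) a (B.subst τ) := by
  induction h with
  | red h h' ih =>
    obtain ⟨τ, hτ⟩ := ih ha
    exact ⟨τ, .red (h.subst h'.ev ha σ) hτ⟩
  | const ι h => exact ⟨σ, .const ι h⟩
  | constApp ι As j B hι h =>
    refine ⟨σ, ?_⟩
    rw [Ty.apps_subst]
    exact .constApp ι _ j _ hι (by simp [h])
  | lam κ A => exact ⟨_, .lam κ _⟩
  | msg1 s A => exact ⟨σ, .msg1 s _⟩
  | msg2 s A => exact ⟨σ, .msg2 s _⟩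
  | seq1 A => exact ⟨σ, .seq1 _⟩
  | msgSeq1 s A B => exact ⟨σ, .msgSeq1 s _ _⟩
  | msgSeq2 s A B => exact ⟨σ, .msgSeq2 s _ _⟩
  | choiceSeq v L As B hl j C h =>
    refine ⟨σ, ?_⟩
    have := Step.choiceSeq v L (As.map (Ty.subst σ)) (B.subst σ) (by simpa using hl) j (C.subst σ)
      (by simp [h])
    simpa [Ty.seq, Ty.subst, Ty.apps_subst] using this
  | finSeq B => exact ⟨σ, .finSeq _⟩
  | _ => exact absurd rfl ha

/-- `Trace A s` says that `s` is the sequence of labels of a run from `A`, where each label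
determines a head other than a type variable. -/
inductive Trace : Ty → List TLabel → Prop
  | nil (A : Ty) : Trace A []
  | cons {A B : Ty} {a : TLabel} {s : List TLabel} (ha : a.head ≠ .neutral) (h : Step A a B)
      (hs : Trace B s) : Trace A (a :: s)

theorem Trace.subst {A : Ty} {s : List TLabel} (h : Trace A s) (σ : ℕ → Ty) :
    Trace (A.subst σ) s := by
  induction h generalizing σ with
  | nil => exact .nil _
  | cons ha h _ ih =>
    obtain ⟨τ, hτ⟩ := h.subst ha σ
    exact .cons ha hτ (ih τ)

theorem Trace.red {A B : Ty} {s : List TLabel} (hr : TyRed A B) (h : Trace B s) : Trace A s := by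
  cases h with
  | nil => exact .nil _
  | cons ha h hs => exact .cons ha (.red hr h) hs

/-- A type with a transition `λ : κ` reduces to an abstraction, so that its applications reduce to
instances of the target. -/
theorem Step.trace_app {A A' B : Ty} {κ : Kind} {s : List TLabel} (h : Step A (.lam κ) A')
    (hs : Trace A' s) : Trace (.app A B) s := by
  generalize hl : TLabel.lam κ = l at h
  induction h with
  | red h _ ih => exact .red (.tappL _ h) (ih hs hl)
  | lam κ A => exact .red (.beta _ _ _) (hs.subst _)
  | _ => cases hl

theorem TyRed.spine_ne {A B : Ty} (h : TyRed A B) {ι : TConst} (hι : Transparent ι) :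
    A.spine.1 ≠ .const ι := by
  intro he
  induction h with
  | tappL B _ ih => exact ih he
  | beta => cases he
  | _ => cases he; cases hι

/-- The transitions of a transparent constant applied to arguments lead to the arguments. -/
theorem Step.arg {ι ι' : TConst} {As : List Ty} {j : ℕ} {B : Ty} (hι : Transparent ι)
    (h : Step (Ty.apps (.const ι) As) (.const ι' (j + 1)) B) : As[j]? = some B := by
  generalize hA : Ty.apps (.const ι) As = A at h
  have hs : A.spine = (.const ι, As) := by rw [← hA, Ty.spine_apps]; rfl
  generalize hl : TLabel.const ι' (j + 1) = l at h
  cases h with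
  | red h _ => exact absurd (congrArg Prod.fst hs) (h.spine_ne hι)
  | constApp ι₂ As₂ j₂ B₂ hι₂ h =>
    rw [Ty.spine_apps] at hs
    cases hs
    cases hl
    exact h
  | const => cases hl
  | lam => cases hl
  | var1 | var2 =>
    rw [Ty.spine_apps] at hs
    cases hs
  | _ => cases hs; cases hι

/-! ### Bisimilarity -/

theorem Bisim.refl (A : Ty) : Bisim A A :=
  ⟨Eq, by rintro A _ rfl a; exact ⟨fun B h => ⟨B, h, rfl⟩, fun B h => ⟨B, h, rfl⟩⟩, rfl⟩

theorem Bisim.step {A B A' : Ty} {a : TLabel} (h : Bisim A B) (hs : Step A a A') :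
    ∃ B', Step B a B' ∧ Bisim A' B' := by
  obtain ⟨R, hR, h⟩ := h
  obtain ⟨B', hB, h'⟩ := (hR A B h a).1 A' hs
  exact ⟨B', hB, R, hR, h'⟩

theorem Bisim.symm {A B : Ty} (h : Bisim A B) : Bisim B A := by
  obtain ⟨R, hR, h⟩ := h
  exact ⟨fun A B => R B A, fun A B h a => (hR B A h a).symm, h⟩

theorem Bisim.trans {A B C : Ty} (h : Bisim A B) (h' : Bisim B C) : Bisim A C := by
  refine ⟨fun A C => ∃ B, Bisim A B ∧ Bisim B C, ?_, B, h, h'⟩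
  rintro A C ⟨B, h, h'⟩ a
  refine ⟨fun A' hA => ?_, fun C' hC => ?_⟩
  · obtain ⟨B', hB, hAB⟩ := h.step hA
    obtain ⟨C', hC, hBC⟩ := h'.step hB
    exact ⟨C', hC, B', hAB, hBC⟩
  · obtain ⟨B', hB, hBC⟩ := h'.symm.step hC
    obtain ⟨A', hA, hAB⟩ := h.symm.step hB
    exact ⟨A', hA, B', hAB.symm, hBC.symm⟩

theorem Trace.bisim {A B : Ty} {s : List TLabel} (hs : Trace A s) (h : Bisim A B) :
    Trace B s := by
  induction hs generalizing B with
  | nil => exact .nil _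
  | cons ha hA _ ih =>
    obtain ⟨B', hB, h'⟩ := h.step hA
    exact .cons ha hB (ih h')

theorem Trace.arg {ι ι' : TConst} {As : List Ty} {j : ℕ} {B : Ty} {s : List TLabel}
    (hι : Transparent ι) (hj : As[j]? = some B)
    (h : Trace (Ty.apps (.const ι) As) (.const ι' (j + 1) :: s)) : Trace B s := by
  cases h with
  | cons _ h hs =>
    rw [h.arg hι, Option.some_inj] at hj
    exact hj ▸ hs

theorem Trace.arrow_dom {A B : Ty} {s : List TLabel}
    (h : Trace (.arrow A B) (.const .arrow 1 :: s)) : Trace A s :=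
  Trace.arg (As := [A, B]) .arrow rfl h

theorem Trace.arrow_cod {A B : Ty} {s : List TLabel}
    (h : Trace (.arrow A B) (.const .arrow 2 :: s)) : Trace B s :=
  Trace.arg (As := [A, B]) .arrow rfl h

/-- Traces of a polymorphic type pass to its instances, at any argument type. -/
theorem Trace.all_inst {A : Ty} {κ κ₁ κ₂ : Kind} {s : List TLabel}
    (h : Trace (.app (.const (.all κ)) A) (.const (.all κ₁) 1 :: .lam κ₂ :: s)) (B : Ty) :
    Trace (.app A B) s := by
  have h' : Trace A (.lam κ₂ :: s) := Trace.arg (As := [A]) (.all κ) rfl h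
  cases h' with
  | cons _ h hs => exact h.trace_app hs

/-! ### Types with a constant at the head -/

/-- Some transition of `A` exhibits the constant `ι`. The condition on the label leaves out the
transitions of `Dual (α A₁ ⋯ Aₘ)`, whose head is neutral. -/
def HasHead (A : Ty) (ι : TConst) : Prop :=
  ∃ i B, (TLabel.const ι i).head = .const ι ∧ Step A (.const ι i) B

theorem HasHead.ev {A : Ty} {ι : TConst} (h : HasHead A ι) : Ev A [] (.const ι) := by
  obtain ⟨i, B, hi, h⟩ := h
  exact hi ▸ h.ev

theorem HasHead.unique {A : Ty} {ι ι' : TConst} (h : HasHead A ι) (h' : HasHead A ι') :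
    ι = ι' := by
  cases h.ev.unique h'.ev
  rfl

theorem HasHead.bisim {A B : Ty} {ι : TConst} (h : HasHead A ι) (hb : Bisim A B) :
    HasHead B ι := by
  obtain ⟨i, A', hi, h⟩ := h
  obtain ⟨B', hB, _⟩ := hb.step h
  exact ⟨i, B', hi, hB⟩

/-- The heads of a type and of its dual are dual. -/
theorem HasHead.dual {A : Ty} {ι ι' : TConst} (h : HasHead A ι) (h' : HasHead (.dual A) ι') :
    ι' = ι.flip := by
  cases (ev_dual.1 h'.ev).unique h.ev.dual_concat
  rfl

theorem Trace.hasHead {A : Ty} {ι : TConst} {i : ℕ} {s : List TLabel}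
    (h : Trace A (.const ι i :: s)) (hi : (TLabel.const ι i).head = .const ι) : HasHead A ι := by
  cases h with
  | cons _ h _ => exact ⟨i, _, hi, h⟩

theorem Transparent.hasHead {ι : TConst} (hι : Transparent ι) (As : List Ty) :
    HasHead (Ty.apps (.const ι) As) ι := by
  cases As with
  | nil => exact ⟨0, _, hι.head 0, .const ι (by rintro rfl; cases hι)⟩
  | cons A As => exact ⟨1, A, hι.head 1, .constApp ι _ 0 A hι rfl⟩

theorem hasHead_arrow (A B : Ty) : HasHead (.arrow A B) .arrow := Transparent.arrow.hasHead [A, B]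

theorem hasHead_all (κ : Kind) (A : Ty) : HasHead (.app (.const (.all κ)) A) (.all κ) :=
  (Transparent.all κ).hasHead [A]

theorem hasHead_record (L : Finset Label) (F : Label → Ty) : HasHead (.record L F) (.record L) :=
  (Transparent.record L).hasHead _

theorem hasHead_variant (L : Finset Label) (F : Label → Ty) :
    HasHead (.variant L F) (.variant L) :=
  (Transparent.variant L).hasHead _

theorem hasHead_choice (v : View) (L : Finset Label) (F : Label → Ty) :
    HasHead (.choice v L F) (.choice v L) :=
  (Transparent.choice v L).hasHead _

/-! ### Session types -/

/-- Type formation without the normalisation requirement. -/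
inductive SKinding : List Kind → Ty → Kind → Prop
  | const (Δ : List Kind) {ι : TConst} {κ : Kind} (h : ConstKind ι κ) : SKinding Δ (.const ι) κ
  | var {Δ : List Kind} {a : ℕ} {κ : Kind} (h : Δ[a]? = some κ) : SKinding Δ (.var a) κ
  | lam {Δ : List Kind} {κ κ' : Kind} {A : Ty} (h : SKinding (κ :: Δ) A κ') :
      SKinding Δ (.lam κ A) (.arr κ κ')
  | app {Δ : List Kind} {κ κ' : Kind} {A B : Ty} (hA : SKinding Δ A (.arr κ κ'))
      (hB : SKinding Δ B κ) : SKinding Δ (.app A B) κ'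

theorem Kinding.skinding {Δ : List Kind} {A : Ty} {κ : Kind} (h : Kinding Δ A κ) :
    SKinding Δ A κ := by
  induction h with
  | const Δ h => exact .const Δ h
  | var h => exact .var h
  | lam _ ih => exact .lam ih
  | app _ _ _ ihA ihB => exact .app ihA ihB

theorem SKinding.rename {Δ Δ' : List Kind} {A : Ty} {κ : Kind} (h : SKinding Δ A κ) {ρ : ℕ → ℕ}
    (hρ : ∀ a κ, Δ[a]? = some κ → Δ'[ρ a]? = some κ) : SKinding Δ' (A.rename ρ) κ := by
  induction h generalizing Δ' ρ with
  | const Δ h => exact .const _ h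
  | var h => exact .var (hρ _ _ h)
  | lam _ ih =>
    refine .lam (ih ?_)
    rintro (_ | a) κ ha
    · simpa using ha
    · exact hρ a κ ha
  | app _ _ ihA ihB => exact .app (ihA hρ) (ihB hρ)

theorem SKinding.shift {Δ : List Kind} {A : Ty} {κ : Kind} (h : SKinding Δ A κ) (κ' : Kind) :
    SKinding (κ' :: Δ) A.shift κ :=
  h.rename fun _ _ ha => ha

theorem SKinding.subst {Δ Δ' : List Kind} {A : Ty} {κ : Kind} (h : SKinding Δ A κ)
    {σ : ℕ → Ty} (hσ : ∀ a κ, Δ[a]? = some κ → SKinding Δ' (σ a) κ) :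
    SKinding Δ' (A.subst σ) κ := by
  induction h generalizing Δ' σ with
  | const Δ h => exact .const _ h
  | var h => exact hσ _ _ h
  | lam _ ih =>
    refine .lam (ih ?_)
    rintro (_ | a) κ ha
    · exact .var (by simpa using ha)
    · exact (hσ a κ ha).shift _
  | app _ _ ihA ihB => exact .app (ihA hσ) (ihB hσ)

theorem SKinding.inst {Δ : List Kind} {A B : Ty} {κ κ' : Kind} (hA : SKinding (κ :: Δ) A κ')
    (hB : SKinding Δ B κ) : SKinding Δ (A.inst B) κ' := by
  refine hA.subst ?_
  rintro (_ | a) κ ha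
  · simp only [List.length_cons, Nat.zero_lt_succ, List.getElem?_eq_getElem, List.getElem_cons_zero,
      Option.some.injEq] at ha
    exact ha ▸ hB
  · exact .var ha

/-- A stack that turns a type of kind `κ` into a type of kind `S`. -/
inductive StackKinding (Δ : List Kind) : List Frame → Kind → Prop
  | nil : StackKinding Δ [] .S
  | app {B : Ty} {K : List Frame} {κ κ' : Kind} (hB : SKinding Δ B κ) (hK : StackKinding Δ K κ') :
      StackKinding Δ (.app B :: K) (.arr κ κ')
  | seq {B : Ty} {K : List Frame} (hB : SKinding Δ B .S) (hK : StackKinding Δ K .S) :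
      StackKinding Δ (.seq B :: K) .S
  | dual {K : List Frame} (hK : StackKinding Δ K .S) : StackKinding Δ (.dual :: K) .S

/-- The constants whose kind ends in `T`. -/
inductive Functional : TConst → Prop
  | arrow : Functional .arrow
  | all (κ : Kind) : Functional (.all κ)
  | record (L : Finset Label) : Functional (.record L)
  | variant (L : Finset Label) : Functional (.variant L)

theorem Functional.of_flip {ι : TConst} {n : ℕ} (h : Functional (TConst.flip^[n] ι)) :
    Functional ι := by
  induction n with
  | zero => exact h
  | succ n ih =>
    rw [Function.iterate_succ_apply'] at h
    refine ih ?_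
    revert h
    generalize TConst.flip^[n] ι = ι'
    cases ι' <;> first | exact id | (intro h; cases h)

theorem StackKinding.not_arrs {Δ : List Kind} {K : List Frame} (κs : List Kind) :
    ¬ StackKinding Δ K (Kind.arrs κs .T) := by
  induction κs generalizing K with
  | nil => intro h; cases h
  | cons κ κs ih =>
    intro h
    cases h with
    | app _ hK => exact ih hK

theorem Functional.not_stackKinding {ι : TConst} (hι : Functional ι) {Δ : List Kind}
    {K : List Frame} {κ : Kind} (hκ : ConstKind ι κ) : ¬ StackKinding Δ K κ := by
  cases hι <;> cases hκ
  · exact StackKinding.not_arrs [_, _]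
  · exact StackKinding.not_arrs [_]
  · exact StackKinding.not_arrs _
  · exact StackKinding.not_arrs _

/-- The machine preserves kinds, and no stack turns a type of kind `T` into a session type. -/
theorem Ev.not_functional {Δ : List Kind} {A : Ty} {K : List Frame} {κ : Kind} {h : Head}
    (he : Ev A K h) (hA : SKinding Δ A κ) (hK : StackKinding Δ K κ) {ι : TConst}
    (hh : h = .const ι) : ¬ Functional ι := by
  induction he generalizing κ with
  | @step A A' K₁ K₂ h hn he ih =>
    unfold next at hn
    split at hn <;> cases hn
    · cases hA with
      | app hA hB => exact ih hA (.app hB hK) hh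
    · cases hA with
      | lam hA => cases hK with
        | app hB hK => exact ih (hA.inst hB) hK hh
    · cases hA with
      | const _ hc => cases hc with
        | mu => cases hK with
          | app hB hK => exact ih hB (.app (.app (.const _ (.mu _)) hB) hK) hh
    · cases hA with
      | const _ hc => cases hc with
        | seq => cases hK with
          | app hB hK => cases hK with
            | app hC hK => exact ih hB (.seq hC hK) hh
    · cases hA with
      | const _ hc => cases hc with
        | dual => cases hK with
          | app hB hK => exact ih hB (.dual hK) hh
    · cases hK with
      | seq hB hK => exact ih hB hK hh
    · cases hK with
      | dual hK => exact ih hA hK hh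
  | @halt A K hn =>
    cases A with
    | const ι' =>
      cases hh
      cases hA with
      | const _ hc => exact fun hf => hf.of_flip.not_stackKinding hc hK
    | _ => cases hh

/-- Types that have kind `S` in some kinding context. -/
def SessionTy (A : Ty) : Prop := ∃ Δ, SKinding Δ A .S

theorem SessionTy.shift {A : Ty} (h : SessionTy A) : SessionTy A.shift := by
  obtain ⟨Δ, h⟩ := h
  exact ⟨.S :: Δ, h.shift .S⟩

theorem SessionTy.dual {A : Ty} (h : SessionTy A) : SessionTy (.dual A) := by
  obtain ⟨Δ, h⟩ := h
  exact ⟨Δ, .app (.const _ .dual) h⟩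

theorem SessionTy.skip : SessionTy .skip := ⟨[], .const _ .skip⟩

theorem SessionTy.not_hasHead {A : Ty} (hA : SessionTy A) {ι : TConst} (hι : Functional ι) :
    ¬ HasHead A ι := by
  obtain ⟨Δ, hA⟩ := hA
  exact fun h => h.ev.not_functional hA .nil rfl hι

/-! ### Typing without linearity -/

/-- Assign the types `As` to the term variables `0, …, As.length - 1`. -/
def extTy (As : List Ty) (G : ℕ → Ty) : ℕ → Ty := fun i => As.getD i (G (i - As.length))

mutual
/-- A relaxed form of typing: every variable has a type and may be used any number of times, type
formation is not checked, and type equivalence is built into each rule. It is defined by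
recursion on the term, so that inversion holds by definition. -/
def Term.WT : Term → (ℕ → Ty) → Ty → Prop
  | .const c, _, C => ∃ A, ConstTy c A ∧ Bisim A C
  | .var x, G, C => Bisim (G x) C
  | .lam A t, G, C => ∃ B, t.WT (extTy [A] G) B ∧ Bisim (.arrow A B) C
  | .fix D v, G, C => ∃ A B, v.WT (extTy [D] G) D ∧ D = .arrow A B ∧ Bisim D C
  | .tlam κ v, G, C => ∃ A B, v.WT (fun x => (G x).shift) B ∧
      Bisim (.app (.const (.all κ)) A) C
  | .record fs, G, C => ∃ F, fs.labels.Nodup ∧ fs.WT G F ∧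
      Bisim (.record fs.labels.toFinset F) C
  | .variant l t A, G, C => ∃ L F, l ∈ L ∧ A = .variant L F ∧ t.WT G (F l) ∧ Bisim A C
  | .app t u, G, C => ∃ A B, t.WT G (.arrow A B) ∧ u.WT G A ∧ Bisim B C
  | .tapp t B, G, C => ∃ κ A, t.WT G (.app (.const (.all κ)) A) ∧ Bisim (.app A B) C
  | .letRec ls t u, G, C => ∃ F B, ls.Nodup ∧ t.WT G (.record ls.toFinset F) ∧
      u.WT (extTy (ls.map F) G) B ∧ Bisim B C
  | .caseOf t u, G, C => ∃ L F B, t.WT G (.variant L F) ∧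
      u.WT G (.record L (fun l => .arrow (F l) B)) ∧ Bisim B C
  | .matchOn t u, G, C => ∃ L F B, t.WT G (.choice .ext L F) ∧
      u.WT G (.record L (fun l => .arrow (F l) B)) ∧ Bisim B C

/-- Relaxed typing of the fields of a record. -/
def Fields.WT : Fields → (ℕ → Ty) → (Label → Ty) → Prop
  | .nil, _, _ => True
  | .cons l t fs, G, F => t.WT G (F l) ∧ fs.WT G F
end

theorem Term.WT.bisim {t : Term} {G : ℕ → Ty} {A B : Ty} (h : t.WT G A) (hb : Bisim A B) :
    t.WT G B := by
  cases t with
  | const | lam | fix | tlam | record | variant | app | tapp | letRec =>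
    simp only [Term.WT] at h ⊢
    grind [Bisim.trans]
  | caseOf | matchOn =>
    obtain ⟨L, F, B', ht, hu, h⟩ := h
    exact ⟨L, F, B', ht, hu, h.trans hb⟩
  | var => exact Bisim.trans h hb

theorem extTy_upRen (As : List Ty) (G : ℕ → Ty) (ρ : ℕ → ℕ) :
    (fun i => extTy As G (upRen As.length ρ i)) = extTy As (fun i => G (ρ i)) := by
  funext i
  unfold extTy upRen
  split
  · rename_i h
    simp [h]
  · rename_i h
    simp [List.getElem?_eq_none (not_lt.1 h)]

theorem Fields.labels_rename (fs : Fields) (ρ : ℕ → ℕ) : (fs.rename ρ).labels = fs.labels := by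
  cases fs with
  | nil => rfl
  | cons l t fs => simp only [Fields.rename, Fields.labels, labels_rename fs]

mutual
theorem Term.wt_rename (t : Term) (ρ : ℕ → ℕ) (G : ℕ → Ty) (C : Ty) :
    (t.rename ρ).WT G C ↔ t.WT (fun x => G (ρ x)) C := by
  cases t with
  | const | var => rfl
  | lam A t =>
    simp only [Term.rename, Term.WT, t.wt_rename, ← extTy_upRen, List.length_singleton]
  | fix A t =>
    simp only [Term.rename, Term.WT, t.wt_rename, ← extTy_upRen, List.length_singleton]
  | tlam κ t => simp only [Term.rename, Term.WT, t.wt_rename]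
  | record fs => simp only [Term.rename, Term.WT, fs.wt_rename, fs.labels_rename]
  | variant l t A => simp only [Term.rename, Term.WT, t.wt_rename]
  | app t u => simp only [Term.rename, Term.WT, t.wt_rename, u.wt_rename]
  | tapp t A => simp only [Term.rename, Term.WT, t.wt_rename]
  | letRec ls t u =>
    simp only [Term.rename, Term.WT, t.wt_rename, u.wt_rename, ← extTy_upRen, List.length_map]
  | caseOf t u => simp only [Term.rename, Term.WT, t.wt_rename, u.wt_rename]
  | matchOn t u => simp only [Term.rename, Term.WT, t.wt_rename, u.wt_rename]

theorem Fields.wt_rename (fs : Fields) (ρ : ℕ → ℕ) (G : ℕ → Ty) (F : Label → Ty) :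
    (fs.rename ρ).WT G F ↔ fs.WT (fun x => G (ρ x)) F := by
  cases fs with
  | nil => rfl
  | cons l t fs => simp only [Fields.rename, Fields.WT, t.wt_rename, fs.wt_rename]
end

/-- The total assignment `G` gives the variables of `Γ` their types in `Γ`. -/
def Ctx.Realised (Γ : Ctx) (G : ℕ → Ty) : Prop := ∀ x b, Γ x = some b → G x = b.ty

theorem Ctx.Split.realised {Γ Γ₁ Γ₂ : Ctx} {G : ℕ → Ty} (h : Γ.Split Γ₁ Γ₂)
    (hG : Γ.Realised G) : Γ₁.Realised G ∧ Γ₂.Realised G := by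
  constructor <;> intro x b hb <;> rcases h x with h | h <;> apply hG <;> grind

theorem Ctx.Realised.extend {Γ : Ctx} {G : ℕ → Ty} (hG : Γ.Realised G) (bs : List Bind) :
    (Γ.extend bs).Realised (extTy (bs.map Bind.ty) G) := by
  intro x b hb
  unfold Ctx.extend at hb
  unfold extTy
  split at hb
  · simp [List.getD_eq_getElem?_getD, hb]
  · rename_i h
    rw [List.getD_eq_default _ _ (by simpa using h), List.length_map]
    exact hG _ _ hb

theorem Ctx.Realised.shift {Γ : Ctx} {G : ℕ → Ty} (hG : Γ.Realised G) :
    Γ.shift.Realised (fun x => (G x).shift) := by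
  intro x b hb
  obtain ⟨b', hb', rfl⟩ := Option.map_eq_some_iff.1 hb
  change (G x).shift = _
  rw [hG x b' hb']
  cases b' <;> rfl

/-- Typed terms are typed without linearity. A contraction renames the term, and its premise is used
with the assignment composed with that renaming. -/
theorem HasType.wt {Δ : List Kind} {Γ : Ctx} {t : Term} {C : Ty} (h : HasType Δ Γ t C)
    {G : ℕ → Ty} (hG : Γ.Realised G) : t.WT G C := by
  induction h using HasType.rec (motive_2 := fun _ Γ fs F _ => ∀ {G : ℕ → Ty}, Γ.Realised G →
    fs.WT G F) generalizing G with
  | const hc hA => exact ⟨_, hc, .refl _⟩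
  | var Δ x A =>
    have := hG x (.lin A) (by simp [Ctx.single, Ctx.set])
    simp only [Term.WT, this]
    exact .refl _
  | abs _ _ ih => exact ⟨_, ih (hG.extend [_]), .refl _⟩
  | app hΓ _ _ iht ihu =>
    obtain ⟨h₁, h₂⟩ := hΓ.realised hG
    exact ⟨_, _, iht h₁, ihu h₂, .refl _⟩
  | fix _ _ _ ih => exact ⟨_, _, ih (hG.extend [_]), rfl, .refl _⟩
  | tabs _ _ ih => exact ⟨_, _, ih hG.shift, .refl _⟩
  | tapp _ _ ih => exact ⟨_, _, ih hG, .refl _⟩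
  | record hl _ ih => exact ⟨_, hl, ih hG, .refl _⟩
  | @proj _ _ _ _ ls F _ _ _ hl hΓ _ _ iht ihu =>
    obtain ⟨h₁, h₂⟩ := hΓ.realised hG
    refine ⟨_, _, hl, iht h₁, ihu ?_, .refl _⟩
    simpa [Function.comp_def, Bind.ty] using h₂.extend (ls.map (fun l => .lin (F l)))
  | variant hl _ _ ih => exact ⟨_, _, hl, rfl, ih hG, .refl _⟩
  | caseOf hΓ _ _ iht ihu =>
    obtain ⟨h₁, h₂⟩ := hΓ.realised hG
    exact ⟨_, _, _, iht h₁, ihu h₂, .refl _⟩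
  | matchOn hΓ _ _ iht ihu =>
    obtain ⟨h₁, h₂⟩ := hΓ.realised hG
    exact ⟨_, _, _, iht h₁, ihu h₂, .refl _⟩
  | eq _ _ h ih => exact (ih hG).bisim h
  | @dereliction _ Γ x A _ _ hx _ ih =>
    refine ih fun y b hb => ?_
    by_cases hy : y = x
    · subst hy
      rw [hx] at hb
      cases hb
      exact hG y (.unr A) (by simp [Ctx.set])
    · exact hG y b (by simp [Ctx.set, hy, hb])
  | @weakening _ Γ x _ _ A hx _ ih =>
    refine ih fun y b hb => hG y b ?_
    have : y ≠ x := by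
      rintro rfl
      simp [hx] at hb
    simpa [Ctx.set, this] using hb
  | @contraction _ Γ x y A _ _ hxy hx hy _ ih =>
    refine (Term.wt_rename _ _ _ _).2 (ih fun z b hb => ?_)
    by_cases hz : z = y
    · subst hz
      rw [hy] at hb
      cases hb
      simpa using hG x (.unr A) (by simp [Ctx.set, hx, hxy])
    · simpa [hz] using hG z b (by simp [Ctx.set, hz, hb])
  | nil => trivial
  | cons hΓ _ _ iht ihs =>
    rename_i hG
    obtain ⟨h₁, h₂⟩ := hΓ.realised hG
    exact ⟨iht h₁, ihs h₂⟩

/-! ### Free term variables -/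

mutual
/-- The variable `x` is free in the term. -/
def Term.Free (x : ℕ) : Term → Prop
  | .const _ => False
  | .var y => y = x
  | .lam _ t => t.Free (x + 1)
  | .fix _ v => v.Free (x + 1)
  | .tlam _ v => v.Free x
  | .record fs => fs.Free x
  | .variant _ t _ => t.Free x
  | .app t u => t.Free x ∨ u.Free x
  | .tapp t _ => t.Free x
  | .letRec ls t u => t.Free x ∨ u.Free (x + ls.length)
  | .caseOf t u => t.Free x ∨ u.Free x
  | .matchOn t u => t.Free x ∨ u.Free x

/-- The variable `x` is free in some field. -/
def Fields.Free (x : ℕ) : Fields → Prop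
  | .nil => False
  | .cons _ t fs => t.Free x ∨ fs.Free x
end

theorem upRen_eq_add_iff {n : ℕ} {ρ : ℕ → ℕ} {x y : ℕ} :
    upRen n ρ y = x + n ↔ ∃ z, y = z + n ∧ ρ z = x := by
  unfold upRen
  split
  · constructor
    · omega
    · rintro ⟨z, rfl, _⟩
      omega
  · constructor
    · intro h
      exact ⟨y - n, by omega, by omega⟩
    · rintro ⟨z, rfl, rfl⟩
      simp

theorem exists_upRen {n : ℕ} {ρ : ℕ → ℕ} {x : ℕ} {P : ℕ → Prop} :
    (∃ y, upRen n ρ y = x + n ∧ P y) ↔ ∃ z, ρ z = x ∧ P (z + n) := by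
  simp only [upRen_eq_add_iff]
  constructor
  · rintro ⟨_, ⟨z, rfl, hz⟩, hP⟩
    exact ⟨z, hz, hP⟩
  · rintro ⟨z, hz, hP⟩
    exact ⟨_, ⟨z, rfl, hz⟩, hP⟩

mutual
theorem Term.free_rename (t : Term) (ρ : ℕ → ℕ) (x : ℕ) :
    (t.rename ρ).Free x ↔ ∃ y, ρ y = x ∧ t.Free y := by
  cases t with
  | const => simp [Term.rename, Term.Free]
  | var y => simp [Term.rename, Term.Free]
  | lam A t => simp only [Term.rename, Term.Free, t.free_rename, exists_upRen]
  | fix A t => simp only [Term.rename, Term.Free, t.free_rename, exists_upRen]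
  | tlam κ t => simp only [Term.rename, Term.Free, t.free_rename]
  | record fs => simp only [Term.rename, Term.Free, fs.free_rename]
  | variant l t A => simp only [Term.rename, Term.Free, t.free_rename]
  | tapp t A => simp only [Term.rename, Term.Free, t.free_rename]
  | app t u | caseOf t u | matchOn t u =>
    simp only [Term.rename, Term.Free, t.free_rename, u.free_rename, ← exists_or, and_or_left]
  | letRec ls t u =>
    simp only [Term.rename, Term.Free, t.free_rename, u.free_rename, exists_upRen, ← exists_or,
      and_or_left]

theorem Fields.free_rename (fs : Fields) (ρ : ℕ → ℕ) (x : ℕ) :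
    (fs.rename ρ).Free x ↔ ∃ y, ρ y = x ∧ fs.Free y := by
  cases fs with
  | nil => simp [Fields.rename, Fields.Free]
  | cons l t fs =>
    simp only [Fields.rename, Fields.Free, t.free_rename, fs.free_rename, ← exists_or,
      and_or_left]
end

theorem Ctx.extend_add (bs : List Bind) (Γ : Ctx) (x : ℕ) :
    Γ.extend bs (x + bs.length) = Γ x := by
  simp [Ctx.extend]

theorem Ctx.Split.ne_none {Γ Γ₁ Γ₂ : Ctx} (h : Γ.Split Γ₁ Γ₂) {x : ℕ}
    (hx : Γ₁ x ≠ none ∨ Γ₂ x ≠ none) : Γ x ≠ none := by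
  rcases h x with h | h <;> grind

theorem HasType.free {Δ : List Kind} {Γ : Ctx} {t : Term} {C : Ty} (h : HasType Δ Γ t C)
    {x : ℕ} (hx : t.Free x) : Γ x ≠ none := by
  induction h using HasType.rec (motive_2 := fun _ Γ fs _ _ => ∀ {x : ℕ}, fs.Free x →
    Γ x ≠ none) generalizing x with
  | const => exact hx.elim
  | var =>
    cases hx
    simp [Ctx.single, Ctx.set]
  | @abs _ Γ _ _ _ _ _ ih => exact Ctx.extend_add [_] Γ x ▸ ih hx
  | app hΓ _ _ iht ihu => exact hΓ.ne_none (hx.imp iht ihu)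
  | @fix _ Γ _ _ _ _ _ _ ih => exact Ctx.extend_add [_] Γ x ▸ ih hx
  | tabs _ _ ih =>
    intro h
    exact ih hx (by simp [Ctx.shift, h])
  | tapp _ _ ih => exact ih hx
  | record _ _ ih => exact ih hx
  | @proj _ _ _ Γ₂ ls F _ _ _ _ hΓ _ _ iht ihu =>
    refine hΓ.ne_none (hx.imp iht fun hx => ?_)
    have := ihu hx
    rwa [← List.length_map (as := ls) (f := fun l => Bind.lin (F l)), Ctx.extend_add] at this
  | variant _ _ _ ih => exact ih hx
  | caseOf hΓ _ _ iht ihu => exact hΓ.ne_none (hx.imp iht ihu)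
  | matchOn hΓ _ _ iht ihu => exact hΓ.ne_none (hx.imp iht ihu)
  | eq _ _ _ ih => exact ih hx
  | dereliction _ _ ih =>
    have := ih hx
    unfold Ctx.set
    split <;> simp [this]
  | weakening _ _ _ ih =>
    have := ih hx
    unfold Ctx.set
    split <;> simp [this]
  | contraction hyz hy hz _ ih =>
    obtain ⟨w, rfl, hw⟩ := (Term.free_rename _ _ _).1 hx
    have := ih hw
    unfold Ctx.set
    grind
  | nil =>
    rename_i hx
    exact hx.elim
  | cons hΓ _ _ iht ihs =>
    rename_i hx
    exact hΓ.ne_none (hx.imp iht ihs)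

/-! ### Subexpressions -/

theorem extTy_session {G : ℕ → Ty} {k : ℕ} (hG : ∀ x ≥ k, SessionTy (G x)) (As : List Ty) :
    ∀ x ≥ k + As.length, SessionTy (extTy As G x) := by
  intro x hx
  unfold extTy
  rw [List.getD_eq_default _ _ (by omega)]
  exact hG _ (by omega)

/-- Subexpressions are typed, and the variables that are not bound inside the surrounding term keep
session types. -/
theorem SubAt.exists_wt {k n : ℕ} {e t : Term} (h : SubAt k e t) {G : ℕ → Ty} {C : Ty}
    (ht : t.WT G C) (hG : ∀ x ≥ n, SessionTy (G x)) :
    ∃ G' C', e.WT G' C' ∧ ∀ x ≥ n + k, SessionTy (G' x) := by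
  induction h using SubAt.rec (motive_2 := fun k e fs _ => ∀ {n : ℕ} {G : ℕ → Ty}
    {F : Label → Ty}, fs.WT G F → (∀ x ≥ n, SessionTy (G x)) →
    ∃ G' C', e.WT G' C' ∧ ∀ x ≥ n + k, SessionTy (G' x)) generalizing n G C with
  | refl e => exact ⟨G, C, ht, hG⟩
  | @lam k _ _ A _ ih =>
    obtain ⟨B, ht, -⟩ := ht
    rw [add_comm k, ← add_assoc]
    exact ih ht (extTy_session hG [A])
  | @fix k _ _ A _ ih =>
    obtain ⟨_, _, ht, -⟩ := ht
    rw [add_comm k, ← add_assoc]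
    exact ih ht (extTy_session hG [A])
  | tlam κ _ ih =>
    obtain ⟨_, _, ht, -⟩ := ht
    exact ih ht fun x hx => (hG x hx).shift
  | record _ ih =>
    obtain ⟨F, -, ht, -⟩ := ht
    exact ih ht hG
  | variant l A _ ih =>
    obtain ⟨_, _, _, _, ht, -⟩ := ht
    exact ih ht hG
  | appL u _ ih =>
    obtain ⟨_, _, ht, -⟩ := ht
    exact ih ht hG
  | appR u _ ih =>
    obtain ⟨_, _, -, ht, -⟩ := ht
    exact ih ht hG
  | tapp A _ ih =>
    obtain ⟨_, _, ht, -⟩ := ht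
    exact ih ht hG
  | letRecL ls u _ ih =>
    obtain ⟨_, _, -, ht, -⟩ := ht
    exact ih ht hG
  | @letRecR k _ _ ls u _ ih =>
    obtain ⟨F, _, -, -, ht, -⟩ := ht
    rw [add_comm k, ← add_assoc]
    refine ih ht ?_
    simpa using extTy_session hG (ls.map F)
  | caseOfL u _ ih =>
    obtain ⟨_, _, _, ht, -⟩ := ht
    exact ih ht hG
  | caseOfR u _ ih =>
    obtain ⟨_, _, _, -, ht, -⟩ := ht
    exact ih ht hG
  | matchOnL u _ ih =>
    obtain ⟨_, _, _, ht, -⟩ := ht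
    exact ih ht hG
  | matchOnR u _ ih =>
    obtain ⟨_, _, _, -, ht, -⟩ := ht
    exact ih ht hG
  | head l fs _ ih =>
    rename_i ht hG
    exact ih ht.1 hG
  | tail l t _ ih =>
    rename_i ht hG
    exact ih ht.2 hG

mutual
theorem EvalPos.exists_wt {e t : Term} (h : EvalPos e t) {G : ℕ → Ty} {C : Ty}
    (ht : t.WT G C) : ∃ C', e.WT G C' := by
  cases h with
  | hole => exact ⟨C, ht⟩
  | appL u h =>
    obtain ⟨_, _, ht, -⟩ := ht
    exact h.exists_wt ht
  | appR hv h =>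
    obtain ⟨_, _, -, ht, -⟩ := ht
    exact h.exists_wt ht
  | tapp A h =>
    obtain ⟨_, _, ht, -⟩ := ht
    exact h.exists_wt ht
  | record h =>
    obtain ⟨_, -, ht, -⟩ := ht
    exact h.exists_wt ht
  | letRec ls u h =>
    obtain ⟨_, _, -, ht, -⟩ := ht
    exact h.exists_wt ht
  | variant l A h =>
    obtain ⟨_, _, -, -, ht, -⟩ := ht
    exact h.exists_wt ht
  | caseOf u h =>
    obtain ⟨_, _, _, ht, -⟩ := ht
    exact h.exists_wt ht
  | matchOn u h =>
    obtain ⟨_, _, _, ht, -⟩ := ht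
    exact h.exists_wt ht

theorem EvalPosF.exists_wt {e : Term} {fs : Fields} (h : EvalPosF e fs) {G : ℕ → Ty}
    {F : Label → Ty} (ht : fs.WT G F) : ∃ C', e.WT G C' := by
  cases h with
  | head l fs h => exact h.exists_wt ht.1
  | tail l hv h => exact h.exists_wt ht.2
end

mutual
theorem EvalPos.free {e t : Term} (h : EvalPos e t) {x : ℕ} (hx : e.Free x) : t.Free x := by
  cases h with
  | hole => exact hx
  | appL u h => exact .inl (h.free hx)
  | appR hv h => exact .inr (h.free hx)
  | tapp A h => exact h.free hx
  | record h => exact h.free hx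
  | letRec ls u h => exact .inl (h.free hx)
  | variant l A h => exact h.free hx
  | caseOf u h => exact .inl (h.free hx)
  | matchOn u h => exact .inl (h.free hx)

theorem EvalPosF.free {e : Term} {fs : Fields} (h : EvalPosF e fs) {x : ℕ} (hx : e.Free x) :
    fs.Free x := by
  cases h with
  | head l fs h => exact .inl (h.free hx)
  | tail l hv h => exact .inr (h.free hx)
end

theorem Subj.free {e : Term} {x : ℕ} (h : Subj e x) : e.Free x := by
  cases h <;> simp [Term.Free]

/-! ### Canonical forms -/

theorem Term.WT.trace_receive {G : ℕ → Ty} {C : Ty} (h : (Term.const .receive).WT G C) :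
    Trace C [.const (.all .T) 1, .lam .T, .const (.all .S) 1, .lam .S, .const .arrow 1,
      .const (.msg .inp) 1] := by
  obtain ⟨A, hA, hb⟩ := h
  cases hA
  refine Trace.bisim ?_ hb
  refine .cons nofun (.constApp _ [_] 0 _ (.all _) rfl) (.cons nofun (.lam _ _) ?_)
  refine .cons nofun (.constApp _ [_] 0 _ (.all _) rfl) (.cons nofun (.lam _ _) ?_)
  exact .cons nofun (.constApp _ [_, _] 0 _ .arrow rfl) (.cons nofun (.msgSeq1 _ _ _) (.nil _))

theorem Term.WT.trace_send {G : ℕ → Ty} {C : Ty} (h : (Term.const .send).WT G C) :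
    Trace C [.const (.all .T) 1, .lam .T, .const .arrow 2, .const (.all .S) 1, .lam .S,
      .const .arrow 1, .const (.msg .out) 1] := by
  obtain ⟨A, hA, hb⟩ := h
  cases hA
  refine Trace.bisim ?_ hb
  refine .cons nofun (.constApp _ [_] 0 _ (.all _) rfl) (.cons nofun (.lam _ _) ?_)
  refine .cons nofun (.constApp _ [_, _] 1 _ .arrow rfl) ?_
  refine .cons nofun (.constApp _ [_] 0 _ (.all _) rfl) (.cons nofun (.lam _ _) ?_)
  exact .cons nofun (.constApp _ [_, _] 0 _ .arrow rfl) (.cons nofun (.msgSeq1 _ _ _) (.nil _))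

theorem Term.WT.trace_tapp {t : Term} {B : Ty} {G : ℕ → Ty} {C : Ty} {κ₁ κ₂ : Kind}
    {s : List TLabel} (h : (Term.tapp t B).WT G C)
    (ht : ∀ {D}, t.WT G D → Trace D (.const (.all κ₁) 1 :: .lam κ₂ :: s)) : Trace C s := by
  obtain ⟨κ, A, h, hb⟩ := h
  exact ((ht h).all_inst B).bisim hb

theorem Term.WT.trace_app {t u : Term} {G : ℕ → Ty} {C : Ty} {s : List TLabel}
    (h : (Term.app t u).WT G C) (ht : ∀ {D}, t.WT G D → Trace D (.const .arrow 2 :: s)) :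
    Trace C s := by
  obtain ⟨A, B, h, -, hb⟩ := h
  exact (ht h).arrow_cod.bisim hb

/-- The forms of a value of type `C`. -/
inductive Canonical : Term → Ty → Prop
  | var (x : ℕ) (C : Ty) : Canonical (.var x) C
  | fn {v : Term} {C : Ty} (hv : AppHead v) (hC : HasHead C .arrow) : Canonical v C
  | poly {v : Term} {C : Ty} {κ : Kind} (hv : TAppHead v) (hC : HasHead C (.all κ)) :
      Canonical v C
  | record {fs : Fields} {C : Ty} (hl : fs.labels.Nodup)
      (hC : HasHead C (.record fs.labels.toFinset)) : Canonical (.record fs) C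
  | variant {l : Label} {L : Finset Label} (hl : l ∈ L) (u : Term) (A : Ty) {C : Ty}
      (hC : HasHead C (.variant L)) : Canonical (.variant l u A) C

theorem IsValue.canonical {v : Term} (hv : IsValue v) {G : ℕ → Ty} {C : Ty} (h : v.WT G C) :
    Canonical v C := by
  cases hv with
  | const c =>
    obtain ⟨A, hA, hb⟩ := h
    cases hA with
    | receive => exact .poly .receive ((hasHead_all _ _).bisim hb)
    | send => exact .poly .send ((hasHead_all _ _).bisim hb)
    | select => exact .fn (.select _ _) ((hasHead_arrow _ _).bisim hb)
    | close => exact .fn .close ((hasHead_arrow _ _).bisim hb)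
    | fork => exact .fn .fork ((hasHead_arrow _ _).bisim hb)
    | new => exact .poly .new ((hasHead_all _ _).bisim hb)
  | var x => exact .var x C
  | lam A t =>
    obtain ⟨B, -, hb⟩ := h
    exact .fn (.lam _ _) ((hasHead_arrow _ _).bisim hb)
  | fix A _ =>
    obtain ⟨A, B, -, rfl, hb⟩ := h
    exact .fn (.fix _ _) ((hasHead_arrow _ _).bisim hb)
  | tlam κ _ =>
    obtain ⟨A, B, -, hb⟩ := h
    exact .poly (.tlam _ _) ((hasHead_all _ _).bisim hb)
  | record _ =>
    obtain ⟨F, hl, -, hb⟩ := h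
    exact .record hl ((hasHead_record _ _).bisim hb)
  | variant l A _ =>
    obtain ⟨L, F, hl, rfl, -, hb⟩ := h
    exact .variant hl _ _ ((hasHead_variant _ _).bisim hb)
  | receive1 A => exact .poly (.receive1 A) ((h.trace_tapp Term.WT.trace_receive).hasHead rfl)
  | receive2 A B =>
    exact .fn (.receive A B)
      ((h.trace_tapp fun h => h.trace_tapp Term.WT.trace_receive).hasHead rfl)
  | send1 A => exact .fn (.send1 A) ((h.trace_tapp Term.WT.trace_send).hasHead rfl)
  | send2 A _ =>
    exact .poly (.send2 A _)
      ((h.trace_app fun h => h.trace_tapp Term.WT.trace_send).hasHead rfl)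
  | send3 A B _ =>
    exact .fn (.send3 A _ B)
      ((h.trace_tapp fun h => h.trace_app fun h => h.trace_tapp Term.WT.trace_send).hasHead rfl)

/-- A variable of session type is not a function, record, variant or polymorphic value. -/
theorem Term.WT.not_hasHead_var {x : ℕ} {G : ℕ → Ty} {C : Ty} (h : (Term.var x).WT G C)
    (hx : SessionTy (G x)) {ι : TConst} (hι : Functional ι) : ¬ HasHead C ι :=
  fun hC => hx.not_hasHead hι (hC.bisim (Bisim.symm h))

theorem Term.WT.labels_eq {fs : Fields} {G : ℕ → Ty} {L : Finset Label} {F : Label → Ty}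
    (h : (Term.record fs).WT G (.record L F)) : fs.labels.toFinset = L := by
  obtain ⟨F', -, -, hb⟩ := h
  cases ((hasHead_record _ F').bisim hb).unique (hasHead_record L F)
  rfl

/-! ### Session operations -/

/-- `Expects G e t ι` says that the session operation `e` on `t` requires the type of `t` to have
the constant `ι` at its head. -/
inductive Expects (G : ℕ → Ty) : Term → Term → TConst → Prop
  | receive (A B : Ty) (t : Term) :
      Expects G (.app (.tapp (.tapp (.const .receive) A) B) t) t (.msg .inp)
  | send (A : Ty) {v : Term} (B : Ty) (t : Term) (hv : IsValue v) :
      Expects G (.app (.tapp (.app (.tapp (.const .send) A) v) B) t) t (.msg .out)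
  | matchOn (t : Term) {u : Term} {L : Finset Label} {F : Label → Ty}
      (hu : u.WT G (.record L F)) : Expects G (.matchOn t u) t (.choice .ext L)
  | select {l : Label} (A : Ty) (t : Term) {L : Finset Label} (hl : l ∈ L) :
      Expects G (.app (.const (.select l A)) t) t (.choice .int L)
  | close (t : Term) : Expects G (.app (.const .close) t) t .fin

theorem SessionOp.expects {e t : Term} (h : SessionOp e t) {G : ℕ → Ty} {C : Ty}
    (he : e.WT G C) : ∃ D ι, t.WT G D ∧ HasHead D ι ∧ Expects G e t ι := by
  cases h with
  | receive A B t =>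
    obtain ⟨D, _, hf, ht, -⟩ := he
    have := hf.trace_tapp fun h => h.trace_tapp Term.WT.trace_receive
    exact ⟨D, _, ht, this.arrow_dom.hasHead rfl, .receive A B t⟩
  | send A B t hv =>
    obtain ⟨D, _, hf, ht, -⟩ := he
    have := hf.trace_tapp fun h => h.trace_app fun h => h.trace_tapp Term.WT.trace_send
    exact ⟨D, _, ht, this.arrow_dom.hasHead rfl, .send A B t hv⟩
  | matchOn t u =>
    obtain ⟨L, F, B, ht, hu, -⟩ := he
    exact ⟨_, _, ht, hasHead_choice _ _ _, .matchOn t hu⟩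
  | select l A t =>
    obtain ⟨D, _, ⟨_, hc, hb⟩, ht, -⟩ := he
    cases hc with
    | select l L F hl =>
      obtain ⟨D', hD, hb'⟩ := hb.step (.constApp .arrow [_, _] 0 _ .arrow rfl)
      obtain rfl : D = D' := Option.some_inj.1 (Step.arg (As := [_, _]) .arrow hD)
      exact ⟨D, _, ht, (hasHead_choice _ _ _).bisim hb', .select _ t hl⟩
  | close t =>
    obtain ⟨D, _, ⟨_, hc, hb⟩, ht, -⟩ := he
    cases hc
    obtain ⟨D', hD, hb'⟩ := hb.step (.constApp .arrow [_, _] 0 _ .arrow rfl)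
    obtain rfl : D = D' := Option.some_inj.1 (Step.arg (As := [_, _]) .arrow hD)
    exact ⟨D, .fin, ht, HasHead.bisim ⟨0, _, rfl, .const .fin nofun⟩ hb', .close t⟩

/-- Two session operations on the ends of a channel agree if the type of one end has
the dual of the head of the type of the other end. -/
theorem Expects.agree {G : ℕ → Ty} (hG : ∀ x, SessionTy (G x)) {e₁ e₂ : Term} {x y : ℕ}
    {ι : TConst} (h₁ : Expects G e₁ (.var x) ι) (h₂ : Expects G e₂ (.var y) ι.flip) :
    Agree x y e₁ e₂ := by
  -- An evaluated branch expression is a record, as no variable has a record type.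
  have offers : ∀ {l : Label} {L : Finset Label} {u : Term} {F : Label → Ty}, l ∈ L →
      u.WT G (.record L F) → Offers l u := by
    intro l L u F hl hu
    by_cases hv : IsValue u
    · generalize hC : Ty.record L F = C at hu
      have hh : HasHead C (.record L) := hC ▸ hasHead_record L F
      cases hv.canonical hu with
      | var z => exact absurd hh (hu.not_hasHead_var (hG z) (.record L))
      | fn _ hC => cases hC.unique hh
      | poly _ hC => cases hC.unique hh
      | record _ hC =>
        cases hC.unique hh
        exact .inl ⟨_, rfl, List.mem_toFinset.1 hl⟩
      | variant _ _ _ hC => cases hC.unique hh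
    · by_cases hr : ∃ fs, u = .record fs
      · obtain ⟨fs, rfl⟩ := hr
        exact .inl ⟨fs, rfl, List.mem_toFinset.1 (hu.labels_eq ▸ hl)⟩
      · exact .inr ⟨hv, fun fs h => hr ⟨fs, h⟩⟩
  generalize hι : ι.flip = ι' at h₂
  cases h₁ with
  | receive A B =>
    cases h₂ <;> cases hι
    exact .receiveSend _ _ _ _ ‹_›
  | send A B _ hv =>
    cases h₂ <;> cases hι
    exact .sendReceive _ _ _ _ hv
  | matchOn _ hu =>
    cases h₂ <;> cases hι
    exact .matchSelect _ (offers ‹_› hu)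
  | select A _ hl =>
    cases h₂ <;> cases hι
    exact .selectMatch _ (offers hl ‹_›)
  | close =>
    cases h₂ <;> cases hι
    exact .close

/-! ### Erroneous expressions -/

/-- A typed expression is not erroneous if the variables that count as free in it have session
types. -/
theorem Term.WT.not_badExpr {e : Term} {G : ℕ → Ty} {C : Ty} {k : ℕ} (h : e.WT G C)
    (hG : ∀ x ≥ k, SessionTy (G x)) : ¬ BadExpr k e := by
  have session : ∀ {x : ℕ}, ¬ BoundVar k (.var x) → SessionTy (G x) := by
    intro x hx
    exact hG x (not_lt.1 fun h => hx ⟨x, h, rfl⟩)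
  intro hbad
  cases hbad with
  | app hv hu hb hbad =>
    obtain ⟨A, B, hf, -, -⟩ := h
    have hh := hasHead_arrow A B
    cases hv.canonical hf with
    | var x => exact hf.not_hasHead_var (session hb) .arrow hh
    | fn hv _ => exact hbad hv
    | poly _ hC => cases hC.unique hh
    | record _ hC => cases hC.unique hh
    | variant _ _ _ hC => cases hC.unique hh
  | tapp B hv hb hbad =>
    obtain ⟨κ, A, hf, -⟩ := h
    have hh := hasHead_all κ A
    cases hv.canonical hf with
    | var x => exact hf.not_hasHead_var (session hb) (.all κ) hh
    | fn _ hC => cases hC.unique hh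
    | poly hv _ => exact hbad hv
    | record _ hC => cases hC.unique hh
    | variant _ _ _ hC => cases hC.unique hh
  | @letRec ls _ t hv hb hbad =>
    obtain ⟨F, B, hl, hf, -⟩ := h
    generalize hC : Ty.record ls.toFinset F = C at hf
    have hh : HasHead C (.record ls.toFinset) := hC ▸ hasHead_record _ F
    cases hv.canonical hf with
    | var x => exact hf.not_hasHead_var (session hb) (.record _) hh
    | fn _ hC => cases hC.unique hh
    | poly _ hC => cases hC.unique hh
    | record hl' hC =>
      refine hbad _ rfl (List.perm_of_nodup_nodup_toFinset_eq hl' hl ?_)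
      exact TConst.record.inj (hC.unique hh)
    | variant _ _ _ hC => cases hC.unique hh
  | caseScrut t hv hb hbad =>
    obtain ⟨L, F, B, hf, -⟩ := h
    generalize hC : Ty.variant L F = C at hf
    have hh : HasHead C (.variant L) := hC ▸ hasHead_variant L F
    cases hv.canonical hf with
    | var x => exact hf.not_hasHead_var (session hb) (.variant _) hh
    | fn _ hC => cases hC.unique hh
    | poly _ hC => cases hC.unique hh
    | record _ hC => cases hC.unique hh
    | variant => exact hbad _ _ _ rfl
  | caseLabel A hu hbad =>
    obtain ⟨L, F, B, ⟨L', F', hl, rfl, -, hb⟩, hr, -⟩ := h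
    cases ((hasHead_variant L' F').bisim hb).unique (hasHead_variant L F)
    exact hbad (List.mem_toFinset.1 (hr.labels_eq ▸ hl))
  | caseBranches _ hv hb hbad =>
    obtain ⟨L, F, B, -, hf, -⟩ := h
    generalize hC : Ty.record L _ = C at hf
    have hh : HasHead C (.record L) := hC ▸ hasHead_record L _
    cases hv.canonical hf with
    | var x => exact hf.not_hasHead_var (session hb) (.record _) hh
    | fn _ hC => cases hC.unique hh
    | poly _ hC => cases hC.unique hh
    | record => exact hbad _ rfl
    | variant _ _ _ hC => cases hC.unique hh
  | endpoint he hv hbad =>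
    obtain ⟨D, ι, ht, hD, hι⟩ := he.expects h
    cases hv.canonical ht with
    | var x => exact hbad x rfl
    | fn _ hC => cases hC.unique hD; cases hι
    | poly _ hC => cases hC.unique hD; cases hι
    | record _ hC => cases hC.unique hD; cases hι
    | variant _ _ _ hC => cases hC.unique hD; cases hι

/-! ### Processes -/

/-- The variable `x` is free in the process. -/
def Proc.Free (x : ℕ) : Proc → Prop
  | .thread t => t.Free x
  | .par p q => p.Free x ∨ q.Free x
  | .nu p => p.Free (x + 2)

/-- Relaxed typing of processes. All that remains of linearity is that no variable is free in both
components of a parallel composition. -/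
def Proc.WT : Proc → (ℕ → Ty) → Prop
  | .thread t, G => t.WT G .unit
  | .par p q, G => p.WT G ∧ q.WT G ∧ ∀ x, p.Free x → ¬ q.Free x
  | .nu p, G => ∃ A, SessionTy A ∧ p.WT (extTy [A, .dual A] G)

theorem Proc.free_rename (p : Proc) (ρ : ℕ → ℕ) (x : ℕ) :
    (p.rename ρ).Free x ↔ ∃ y, ρ y = x ∧ p.Free y := by
  induction p generalizing ρ x with
  | thread t => exact t.free_rename ρ x
  | par p q ihp ihq =>
    simp only [Proc.rename, Proc.Free, ihp, ihq, ← exists_or, and_or_left]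
  | nu p ih => simp only [Proc.rename, Proc.Free, ih, exists_upRen]

theorem upRen_injective {ρ : ℕ → ℕ} (hρ : ρ.Injective) (n : ℕ) : (upRen n ρ).Injective := by
  intro i j hij
  unfold upRen at hij
  split at hij <;> split at hij
  · exact hij
  · omega
  · omega
  · have := @hρ (i - n) (j - n) (by omega)
    omega

theorem Proc.wt_rename (p : Proc) {ρ : ℕ → ℕ} (hρ : ρ.Injective) (G : ℕ → Ty) :
    (p.rename ρ).WT G ↔ p.WT (fun x => G (ρ x)) := by
  induction p generalizing ρ G with
  | thread t => exact t.wt_rename ρ G _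
  | par p q ihp ihq =>
    simp only [Proc.rename, Proc.WT, ihp hρ, ihq hρ, Proc.free_rename]
    refine and_congr_right fun _ => and_congr_right fun _ => ?_
    constructor
    · exact fun h x hp hq => h _ ⟨x, rfl, hp⟩ ⟨x, rfl, hq⟩
    · rintro h _ ⟨x, rfl, hp⟩ ⟨y, hxy, hq⟩
      exact h x hp (hρ hxy ▸ hq)
  | nu p ih =>
    simp only [Proc.rename, Proc.WT, ih (upRen_injective hρ 2)]
    refine exists_congr fun A => and_congr_right fun _ => ?_
    rw [← extTy_upRen [A, .dual A] G ρ]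
    rfl

theorem ProcType.free {Γ : Ctx} {p : Proc} (h : ProcType Γ p) {x : ℕ} (hx : p.Free x) :
    Γ x ≠ none := by
  induction h generalizing x with
  | thread h => exact h.free hx
  | par hΓ _ _ ihp ihq => exact hΓ.ne_none (hx.imp ihp ihq)
  | @nu Γ _ _ _ _ ih => exact Ctx.extend_add [_, _] Γ x ▸ ih hx

theorem ProcType.wt {Γ : Ctx} {p : Proc} (h : ProcType Γ p) {G : ℕ → Ty} (hG : Γ.Realised G) :
    p.WT G := by
  induction h generalizing G with
  | thread h => exact h.wt hG
  | par hΓ hp hq ihp ihq =>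
    obtain ⟨h₁, h₂⟩ := hΓ.realised hG
    refine ⟨ihp h₁, ihq h₂, fun x hxp hxq => ?_⟩
    rcases hΓ x with h | h
    · exact hq.free hxq h.2
    · exact hp.free hxp h.1
  | nu hA _ ih => exact ⟨_, ⟨_, hA.skinding⟩, ih (hG.extend [_, _])⟩

theorem swapNu_injective : swapNu.Injective := by
  have h : ∀ n, swapNu (swapNu n) = n := by
    rintro (_ | _ | _ | _ | n) <;> rfl
  exact Function.LeftInverse.injective h

theorem Cong.free_iff {p q : Proc} (h : Cong p q) (x : ℕ) : p.Free x ↔ q.Free x := by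
  induction h generalizing x with
  | refl => rfl
  | symm _ ih => exact (ih x).symm
  | trans _ _ ih ih' => exact (ih x).trans (ih' x)
  | par _ _ ih ih' => exact or_congr (ih x) (ih' x)
  | nu _ ih => exact ih _
  | comm => exact or_comm
  | assoc => exact or_assoc
  | extrude p q => simp [Proc.Free, Proc.free_rename]
  | swap p =>
    simp only [Proc.Free, Proc.free_rename]
    constructor
    · exact fun h => ⟨_, rfl, h⟩
    · rintro ⟨y, hy, h⟩
      rwa [swapNu_injective (hy.trans (show x + 2 + 2 = swapNu (x + 2 + 2) from rfl))] at h

/-- Relaxed typing is invariant under structural congruence. -/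
theorem Cong.wt_iff {p q : Proc} (h : Cong p q) (G : ℕ → Ty) : p.WT G ↔ q.WT G := by
  induction h generalizing G with
  | refl => rfl
  | symm _ ih => exact (ih G).symm
  | trans _ _ ih ih' => exact (ih G).trans (ih' G)
  | par h h' ih ih' => simp only [Proc.WT, ih, ih', h.free_iff, h'.free_iff]
  | nu _ ih => simp only [Proc.WT, ih]
  | comm => simp only [Proc.WT]; grind
  | assoc => simp only [Proc.WT, Proc.Free]; grind
  | extrude p q =>
    have hq : ∀ A, (q.rename (· + 2)).WT (extTy [A, .dual A] G) ↔ q.WT G := fun A =>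
      q.wt_rename (add_left_injective 2) _
    have hd : (∀ x, p.Free x → ¬ (q.rename (· + 2)).Free x) ↔
        ∀ x, p.Free (x + 2) → ¬ q.Free x := by
      simp only [Proc.free_rename]
      grind
    simp only [Proc.WT, Proc.Free, hq, hd]
    grind
  | swap p =>
    have hs : ∀ A B, (p.rename swapNu).WT (extTy [A, .dual A] (extTy [B, .dual B] G)) ↔
        p.WT (extTy [B, .dual B] (extTy [A, .dual A] G)) := by
      intro A B
      rw [p.wt_rename swapNu_injective]
      refine iff_of_eq (congrArg _ (funext ?_))
      rintro (_ | _ | _ | _ | n) <;> rfl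
    simp only [Proc.WT, hs]
    grind

theorem SubProc.exists_wt {q p : Proc} (h : SubProc q p) {G : ℕ → Ty} (hp : p.WT G)
    (hG : ∀ x, SessionTy (G x)) : ∃ G', q.WT G' ∧ ∀ x, SessionTy (G' x) := by
  induction h generalizing G with
  | refl => exact ⟨G, hp, hG⟩
  | parL _ _ ih => exact ih hp.1 hG
  | parR _ _ ih => exact ih hp.2.1 hG
  | nu _ ih =>
    obtain ⟨A, hA, hp⟩ := hp
    refine ih hp ?_
    rintro (_ | _ | x)
    · exact hA
    · exact hA.dual
    · exact hG x

theorem Proc.WT.not_hasError {p : Proc} {G : ℕ → Ty} (hp : p.WT G)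
    (hG : ∀ x, SessionTy (G x)) : ¬ HasError p := by
  intro herr
  cases herr with
  | expr ht he hbad =>
    obtain ⟨G', ht, hG'⟩ := ht.exists_wt hp hG
    obtain ⟨G'', C, he, hG''⟩ := he.exists_wt (n := 0) ht fun x _ => hG' x
    exact he.not_badExpr (by simpa using hG'') hbad
  | sameEnd hs h₁ h₂ s₁ s₂ =>
    obtain ⟨G', ⟨-, -, hd⟩, -⟩ := hs.exists_wt hp hG
    exact hd _ (h₁.free s₁.free) (h₂.free s₂.free)
  | mismatch hs h₁ h₂ s₁ s₂ hbad =>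
    obtain ⟨G', ⟨A, hA, ht₁, ht₂, -⟩, hG'⟩ := hs.exists_wt hp hG
    obtain ⟨C₁, he₁⟩ := h₁.exists_wt ht₁
    obtain ⟨C₂, he₂⟩ := h₂.exists_wt ht₂
    obtain ⟨D₁, ι₁, hx, hD₁, h₁⟩ := SessionOp.expects s₁ he₁
    obtain ⟨D₂, ι₂, hy, hD₂, h₂⟩ := SessionOp.expects s₂ he₂
    have hA₁ : HasHead A ι₁ := hD₁.bisim (Bisim.symm hx)
    have hA₂ : HasHead (.dual A) ι₂ := hD₂.bisim (Bisim.symm hy)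
    cases hA₁.dual hA₂
    refine hbad (h₁.agree ?_ h₂)
    rintro (_ | _ | x)
    · exact hA
    · exact hA.dual
    · exact hG' x

end FMu

theorem mainTheorem8 (Γ : FMu.Ctx) (p : FMu.Proc) (hΓ : Γ.Session) (hp : FMu.ProcType Γ p) :
    ¬ FMu.RuntimeError p := by
  rintro ⟨q, hpq, hq⟩
  -- Variables outside the context do not occur in `p`; any session type will do for them.
  let G : ℕ → FMu.Ty := fun x => ((Γ x).map FMu.Bind.ty).getD .skip
  have hG : Γ.Realised G := fun x b hb => by simp [G, hb]
  have hS : ∀ x, FMu.SessionTy (G x) := by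
    intro x
    rcases hx : Γ x with _ | b
    · simpa [G, hx] using FMu.SessionTy.skip
    · simpa [G, hx] using ⟨_, (hΓ x b hx).skinding⟩
  exact ((hpq.wt_iff G).1 (hp.wt hG)).not_hasError hS hq
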